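/- Let $\eta,\theta,q\in\mathbb R$. A \emph{bi-Poisson process} with parameters $(\eta,\theta,q)$ is a square-integrable real Markov process $(X_t)_{t\ge 0}$ (Markov with respect to its natural filtration) such that, for all $s,t\ge 0$, $$E(X_t)=0,\qquad E(X_tX_s)=\min\{t,s\},$$ and, for all $0\le s<t<u$, with $\mathcal F_{s,u}=\sigma\{X_r:\ 0\le r\le s\ \text{or}\ r>u\}$, almost surely $$E(X_t\mid\mathcal F_{s,u})=\frac{u-t}{u-s}X_s+\frac{t-s}{u-s}X_u,$$ $$\mathrm{Var}(X_t\mid\mathcal F_{s,u})=\frac{(u-t)(t-s)}{u-qs}\left(1+\eta\,\frac{uX_s-sX_u}{u-s}+\theta\,\frac{X_u-X_s}{u-s}-(1-q)\frac{(uX_s-sX_u)(X_u-X_s)}{(u-s)^2}\right).$$ \textbf{Proposition (Time-inversion).} Let $(X_t)_{t\ge0}$ be a bi-Poisson process with parameters $(\theta,\theta,q)$. Then the time-inverted process $(tX_{1/t})_{t>0}$ has the same finite-dimensional distributions as $(X_t)_{t>0}$. Moreover, suppose that $q=1$ and $\theta>0$, and let $(Z_t)_{t\ge 0}$ be a process such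 that $$X_t=\begin{cases}\theta(1-t)Z_t-\dfrac t\theta,&0\le t<1,\\[1ex] \theta Z_1-\dfrac1\theta,&t=1,\\[1ex] \theta(t-1)Z_t-\dfrac1\theta,&t>1.\end{cases}$$ Then $(Z_t)_{t>0}$ and $(Z_{1/t})_{t>0}$ have the same transition probabilities: for all $0<s<t$, the variables $Z_s$ and $Z_{1/s}$ have the same law, and the conditional law of $Z_t$ given $Z_s=z$ equals the conditional law of $Z_{1/t}$ given $Z_{1/s}=z$, for almost every $z$ with respect to that common law. -/

import Mathlib

open MeasureTheory ProbabilityTheory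
open scoped NNReal

/-- The σ-algebra of the past up to (and including) time `s`, generated by `X r`, `r ≤ s`. -/
abbrev pastSigma {Ω : Type*} (X : ℝ≥0 → Ω → ℝ) (s : ℝ≥0) : MeasurableSpace Ω :=
  ⨆ r ∈ {r : ℝ≥0 | r ≤ s}, MeasurableSpace.comap (X r) inferInstance

/-- The σ-algebra `𝓕_{s,u}` generated by `X r`, where `0 ≤ r ≤ s` or `r > u`. -/
abbrev pastFutureSigma {Ω : Type*} (X : ℝ≥0 → Ω → ℝ) (s u : ℝ≥0) : MeasurableSpace Ω :=
  ⨆ r ∈ {r : ℝ≥0 | r ≤ s ∨ u < r}, MeasurableSpace.comap (X r) inferInstance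

/-- The Markov property with respect to the natural filtration: for `s ≤ t` the conditional
law of `X t` given the past up to time `s` is its conditional law given `X s`. -/
def HasMarkovProperty {Ω : Type*} [MeasurableSpace Ω] (P : Measure Ω)
    (X : ℝ≥0 → Ω → ℝ) : Prop :=
  ∀ s t : ℝ≥0, s ≤ t → ∀ B : Set ℝ, MeasurableSet B →
    P⟦X t ⁻¹' B | pastSigma X s⟧ =ᵐ[P]
      P⟦X t ⁻¹' B | MeasurableSpace.comap (X s) inferInstance⟧

/-- A bi-Poisson process `(X_t)_{t ≥ 0}` with parameters `(η, θ, q)`: a square-integrable Markov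
process with the stated covariance, linear conditional expectations (harness property), and
quadratic conditional variances. -/
structure IsBiPoisson {Ω : Type*} [MeasurableSpace Ω] (P : Measure Ω) (η θ q : ℝ)
    (X : ℝ≥0 → Ω → ℝ) : Prop where
  measurable : ∀ t, Measurable (X t)
  square_integrable : ∀ t, MemLp (X t) 2 P
  markov : HasMarkovProperty P X
  mean : ∀ t, ∫ ω, X t ω ∂P = 0
  covariance : ∀ s t, ∫ ω, X t ω * X s ω ∂P = ((min t s : ℝ≥0) : ℝ)
  harness : ∀ s t u : ℝ≥0, s < t → t < u →
    P[X t | pastFutureSigma X s u] =ᵐ[P]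
      fun ω => ((u : ℝ) - t) / ((u : ℝ) - s) * X s ω + ((t : ℝ) - s) / ((u : ℝ) - s) * X u ω
  quadratic_variance : ∀ s t u : ℝ≥0, s < t → t < u →
    Var[X t; P | pastFutureSigma X s u] =ᵐ[P]
      fun ω => ((u : ℝ) - t) * ((t : ℝ) - s) / ((u : ℝ) - q * s) *
        (1 + η * ((u * X s ω - s * X u ω) / ((u : ℝ) - s))
          + θ * ((X u ω - X s ω) / ((u : ℝ) - s))
          - (1 - q) * ((u * X s ω - s * X u ω) * (X u ω - X s ω) / ((u : ℝ) - s) ^ 2))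

/-- The time-inverted process `(t X_{1/t})_{t > 0}`. -/
noncomputable def timeInversion {Ω : Type*} (X : ℝ≥0 → Ω → ℝ) (t : Set.Ioi (0 : ℝ≥0)) (ω : Ω) :
    ℝ :=
  ((t : ℝ≥0) : ℝ) * X (t : ℝ≥0)⁻¹ ω

/-- Two real-valued processes on the same probability space have the same finite-dimensional
distributions. -/
def SameFiniteDimLaws {Ω T : Type*} [MeasurableSpace Ω] (P : Measure Ω) (X Y : T → Ω → ℝ) : Prop :=
  ∀ I : Finset T,
    P.map (fun ω (t : I) => X (t : T) ω) = P.map (fun ω (t : I) => Y (t : T) ω)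

/-- The value `X_t` that corresponds to the value `z = Z_t` of the auxiliary (pure birth, then
pure death) process: `θ(1-t)z - t/θ` if `t < 1`, `θz - 1/θ` if `t = 1`, and `θ(t-1)z - 1/θ` if
`t > 1`. -/
noncomputable def valueOfLine (θ : ℝ) (t : ℝ≥0) (z : ℝ) : ℝ :=
  if t < 1 then θ * (1 - (t : ℝ)) * z - t / θ
  else if t = 1 then θ * z - 1 / θ
  else θ * ((t : ℝ) - 1) * z - 1 / θ

/-- `(Z_t)_{t>0}` and `(Z_{1/t})_{t>0}` have the same transition probabilities: for `0 < s < t`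
the conditional law of `Z_t` given `Z_s` and that of `Z_{1/t}` given `Z_{1/s}` are the same kernel,
up to null sets of the common law of `Z_s` and `Z_{1/s}`. -/
def SameTransitionsInverted {Ω : Type*} [MeasurableSpace Ω] (P : Measure Ω) [IsFiniteMeasure P]
    (Z : ℝ≥0 → Ω → ℝ) : Prop :=
  ∀ s t : ℝ≥0, 0 < s → s < t →
    P.map (Z s) = P.map (Z s⁻¹) ∧
    condDistrib (Z t) (Z s) P =ᵐ[P.map (Z s)] condDistrib (Z t⁻¹) (Z s⁻¹) P

/-!
The proof shows that the parameters `(η, θ, q)` determine all mixed moments of a bi-Poisson process,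
that the time inversion `t X_{1/t}` has the mixed moments that belong to `(θ, η, q)`, and that the
mixed moments determine the finite-dimensional laws.

*Uniqueness of the moments.* Let `E(X_u^j | 𝓕_s)` be known for `j ≤ n`, where `𝓕_s` is the past up
to time `s`. For `s < t < u` the conditional expectations of `X_t X_u^n` and `X_t² X_u^(n-1)` given
`𝓕_s` can be computed in two ways: by conditioning first on the past up to `t`, or first on the
process outside of the interval `(s, u)`, where the harness property and the conditional variance
apply. The two resulting linear equations for `E(X_t^(n+1) | 𝓕_s)` and `E(X_u^(n+1) | 𝓕_s)` have
determinant `(t - s)(u - t) / ((u - s)(u - q s)) ≠ 0`, so that `E(X_u^(n+1) | 𝓕_s)` is a polynomial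
in `X_s` that depends only on the parameters (`hasCondMoment`). Integrating out the latest time
first determines all mixed moments (`IsMomentFunctional.unique`). This part is phrased for linear
functionals on the polynomials in variables `X_t`, `t ≥ 0`; for them time inversion is the
substitution `X_t ↦ t X_{1/t}` (`IsMomentFunctional.invert`).

*Exponential moments.* The definition provides second moments only. Letting `u → ∞` in the two
conditional moment formulas gives the first two conditional moments of `X_t` given the past, and
`s = 0` gives those of `X_s` given `X_t`. For a bounded nondecreasing odd function `f`,
an approximation of `x ↦ sinh (l x)`, the identity
`E((X_t - X_s)(f(X_t) - f(X_s))) = (t - s)/t · E(X_t f(X_t))`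
and the mean value theorem bound `E(X_t f(X_t))` in terms of `f'`, as `s → t`. For small `l` the
bound does not depend on the approximation, so that `cosh (l X_t)` is integrable
(`exists_integrable_exp_abs`).

*Conclusion.* Linear combinations of the variables also have exponential moments, hence their laws
are determined by their moments (`map_eq_of_integral_pow_eq`), and these laws determine the
finite-dimensional laws. The statement about `Z` follows since `Z_t` and `Z_{1/t}` are the same
affine function of `X_t` and of `t X_{1/t}`.
-/

/-! ### Moment functionals of quadratic harnesses -/

namespace QuadraticHarness

open MvPolynomial

/-- The conditional variance of `X_t` given `X_s` and `X_u`, as a polynomial in the variables `X_s`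
and `X_u`. -/
noncomputable def bridgeVariance (η θ q : ℝ) (s t u : ℝ≥0) : MvPolynomial ℝ≥0 ℝ :=
  C (((u : ℝ) - t) * ((t : ℝ) - s) / ((u : ℝ) - q * s)) *
    (1 + C (η / ((u : ℝ) - s)) * (C (u : ℝ) * X s - C (s : ℝ) * X u)
      + C (θ / ((u : ℝ) - s)) * (X u - X s)
      - C ((1 - q) / ((u : ℝ) - s) ^ 2) * ((C (u : ℝ) * X s - C (s : ℝ) * X u) * (X u - X s)))

/-- The linear interpolation of `X_t` between `X_s` and `X_u`, as a polynomial in the variables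
`X_s` and `X_u`. -/
noncomputable def bridgeMean (s t u : ℝ≥0) : MvPolynomial ℝ≥0 ℝ :=
  C (((u : ℝ) - t) / ((u : ℝ) - s)) * X s + C (((t : ℝ) - s) / ((u : ℝ) - s)) * X u

/-- A linear functional on polynomials in the variables `X_t`, `t ≥ 0`, that satisfies the
identities which the functional `f ↦ E(f(X))` of mixed moments of a bi-Poisson process satisfies:
the martingale property and the formulas for the first two conditional moments of `X_t` given the
process outside of `(s, u)`, all tested against polynomials in the conditioning variables. -/
structure IsMomentFunctional (η θ q : ℝ) (L : MvPolynomial ℝ≥0 ℝ →ₗ[ℝ] ℝ) : Prop where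
  map_one : L 1 = 1
  map_X_zero_mul : ∀ f, L (X 0 * f) = 0
  martingale : ∀ s t : ℝ≥0, s < t → ∀ W ∈ supported ℝ (Set.Iic s), L (X t * W) = L (X s * W)
  harness : ∀ s t u : ℝ≥0, s < t → t < u → ∀ W ∈ supported ℝ (Set.Iic s ∪ Set.Ici u),
    L (X t * W) = L (bridgeMean s t u * W)
  quadratic : ∀ s t u : ℝ≥0, s < t → t < u → ∀ W ∈ supported ℝ (Set.Iic s ∪ Set.Ici u),
    L (X t ^ 2 * W) = L ((bridgeMean s t u ^ 2 + bridgeVariance η θ q s t u) * W)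

/-- `SameCondMoment η θ q s t f g` says that `g(X_s)` is the conditional expectation of `f(X_t)`
given the past up to time `s`, for every functional of mixed moments with parameters
`(η, θ, q)`. -/
def SameCondMoment (η θ q : ℝ) (s t : ℝ≥0) (f g : Polynomial ℝ) : Prop :=
  ∀ L, IsMomentFunctional η θ q L → ∀ W ∈ supported ℝ (Set.Iic s),
    L (Polynomial.aeval (X t) f * W) = L (Polynomial.aeval (X s) g * W)

variable {η θ q : ℝ} {s t : ℝ≥0}

lemma SameCondMoment.const_mul {f g : Polynomial ℝ} (h : SameCondMoment η θ q s t f g) (c : ℝ) :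
    SameCondMoment η θ q s t (Polynomial.C c * f) (Polynomial.C c * g) := by
  intro L hL W hW
  have := h L hL W hW
  simp only [map_mul, Polynomial.aeval_C, algebraMap_eq, C_mul', smul_mul_assoc, map_smul, this]

lemma SameCondMoment.sum {ι : Type*} (I : Finset ι) {f g : ι → Polynomial ℝ}
    (h : ∀ i ∈ I, SameCondMoment η θ q s t (f i) (g i)) :
    SameCondMoment η θ q s t (∑ i ∈ I, f i) (∑ i ∈ I, g i) := by
  intro L hL W hW
  simp only [map_sum, Finset.sum_mul]
  exact Finset.sum_congr rfl fun i hi => h i hi L hL W hW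

/-- The `n`-th conditional moment is a monic polynomial of degree `n` in the present state, and this
polynomial is the same for all functionals of mixed moments. -/
def HasCondMoment (η θ q : ℝ) (n : ℕ) : Prop :=
  ∀ s t : ℝ≥0, s < t → ∃ r : Polynomial ℝ, r.degree < n ∧
    SameCondMoment η θ q s t (Polynomial.X ^ n) (Polynomial.X ^ n + r)

lemma exists_sameCondMoment_of_degree_lt {m : ℕ} (h : ∀ k < m, HasCondMoment η θ q k)
    (hst : s < t) {f : Polynomial ℝ} (hf : f.degree < m) :
    ∃ g : Polynomial ℝ, g.degree < m ∧ SameCondMoment η θ q s t f g := by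
  classical
  have h' : ∀ k : ℕ, ∃ g : Polynomial ℝ, k < m → g.degree < m ∧
      SameCondMoment η θ q s t (Polynomial.X ^ k) g := by
    intro k
    by_cases hk : k < m
    · obtain ⟨r, hr, hr'⟩ := h k hk s t hst
      refine ⟨Polynomial.X ^ k + r, fun _ => ⟨?_, hr'⟩⟩
      have hkm : ((k : ℕ) : WithBot ℕ) < m := by exact_mod_cast hk
      exact (Polynomial.degree_add_le _ _).trans_lt
        (max_lt ((Polynomial.degree_X_pow_le k).trans_lt hkm) (hr.trans hkm))
    · exact ⟨0, fun h => absurd h hk⟩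
  choose g hg using h'
  refine ⟨∑ k ∈ Finset.range m, Polynomial.C (f.coeff k) * g k, ?_, ?_⟩
  · rw [← Polynomial.mem_degreeLT]
    refine Submodule.sum_mem _ fun k hk => ?_
    rw [Polynomial.C_mul']
    exact Submodule.smul_mem _ _ (Polynomial.mem_degreeLT.2 (hg k (Finset.mem_range.1 hk)).1)
  · have hf' : f = ∑ k ∈ Finset.range m, Polynomial.C (f.coeff k) * Polynomial.X ^ k := by
      rcases eq_or_ne f 0 with rfl | hf0
      · simp
      · exact Polynomial.as_sum_range_C_mul_X_pow' _
          ((Polynomial.natDegree_lt_iff_degree_lt hf0).2 hf)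
    conv_lhs => rw [hf']
    exact SameCondMoment.sum _ fun k hk => (hg k (Finset.mem_range.1 hk)).2.const_mul _

lemma hasCondMoment_zero : HasCondMoment η θ q 0 := fun s t _ =>
  ⟨0, by simp, fun L _ W _ => by simp⟩

lemma hasCondMoment_one : HasCondMoment η θ q 1 := fun s t hst =>
  ⟨0, by simp, fun L hL W hW => by simpa using hL.martingale s t hst W hW⟩

lemma bridgeMean_sq_add_bridgeVariance (s t u : ℝ≥0) {a b v k : ℝ}
    (ha : a = ((u : ℝ) - t) / ((u : ℝ) - s)) (hb : b = ((t : ℝ) - s) / ((u : ℝ) - s))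
    (hv : v = ((u : ℝ) - t) * ((t : ℝ) - s) / ((u : ℝ) - q * s))
    (hk : k = v * ((1 - q) / ((u : ℝ) - s) ^ 2)) :
    bridgeMean s t u ^ 2 + bridgeVariance η θ q s t u =
      C (a ^ 2 + k * u) * X s ^ 2 + C (2 * a * b - k * (u + s)) * (X s * X u)
        + C (b ^ 2 + k * s) * X u ^ 2
        + C (v * (η / ((u : ℝ) - s)) * u - v * (θ / ((u : ℝ) - s))) * X s
        + C (v * (θ / ((u : ℝ) - s)) - v * (η / ((u : ℝ) - s)) * s) * X u + C v := by
  rw [bridgeMean, bridgeVariance, ← ha, ← hb, ← hv, hk]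
  simp only [C_add, C_sub, C_mul, C_pow]
  have h2 : (C 2 : MvPolynomial ℝ≥0 ℝ) = 2 := rfl
  rw [h2]
  ring

/-- Evaluating the moments of `X_t X_u^(k+1)` and `X_t^2 X_u^k` given the past up to time `s` in two
ways (conditioning on the past up to `t`, or on the process outside `(s, u)`) gives two linear
equations for the conditional moments of order `k + 2` of `X_t` and `X_u`. The system is solvable
because `u ≠ q s`. -/
lemma hasCondMoment_add_two (hq : q ≤ 1) {k : ℕ} (h : ∀ j < k + 2, HasCondMoment η θ q j) :
    HasCondMoment η θ q (k + 2) := by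
  intro s u hsu
  obtain ⟨t, hst, htu⟩ := exists_between hsu
  obtain ⟨r₁, hr₁, h₁⟩ := h (k + 1) (by omega) t u htu
  obtain ⟨r₂, hr₂, h₂⟩ := h k (by omega) t u htu
  obtain ⟨r₃, hr₃, h₃⟩ := h (k + 1) (by omega) s u hsu
  obtain ⟨r₄, hr₄, h₄⟩ := h k (by omega) s u hsu
  have key : ∀ (i j : ℕ) (r : Polynomial ℝ), r.degree < i → i + j ≤ k + 2 →
      Polynomial.X ^ j * r ∈ Polynomial.degreeLT ℝ (k + 2) := by
    intro i j r hr hij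
    rw [Polynomial.mem_degreeLT]
    rcases eq_or_ne r 0 with rfl | h0
    · simp only [mul_zero, Polynomial.degree_zero]; exact WithBot.bot_lt_coe _
    have := (Polynomial.natDegree_lt_iff_degree_lt h0).2 hr
    rw [← Polynomial.natDegree_lt_iff_degree_lt (by simp [h0]),
      Polynomial.natDegree_mul (by simp) h0, Polynomial.natDegree_X_pow]
    omega
  obtain ⟨g₁, hg₁, h₅⟩ := exists_sameCondMoment_of_degree_lt h hst
    (f := Polynomial.X ^ 1 * r₁) (Polynomial.mem_degreeLT.1 (key _ 1 r₁ hr₁ (by omega)))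
  obtain ⟨g₂, hg₂, h₆⟩ := exists_sameCondMoment_of_degree_lt h hst
    (f := Polynomial.X ^ 2 * r₂) (Polynomial.mem_degreeLT.1 (key _ 2 r₂ hr₂ (by omega)))
  have hst' : (s : ℝ) < t := hst
  have htu' : (t : ℝ) < u := htu
  have hs0 : (0 : ℝ) ≤ s := s.2
  have hus : (0 : ℝ) < (u : ℝ) - s := by linarith
  have huqs : (0 : ℝ) < (u : ℝ) - q * s := by nlinarith
  obtain ⟨a, ha⟩ : ∃ a, a = ((u : ℝ) - t) / ((u : ℝ) - s) := ⟨_, rfl⟩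
  obtain ⟨b, hb⟩ : ∃ b, b = ((t : ℝ) - s) / ((u : ℝ) - s) := ⟨_, rfl⟩
  obtain ⟨v, hv⟩ : ∃ v, v = ((u : ℝ) - t) * ((t : ℝ) - s) / ((u : ℝ) - q * s) := ⟨_, rfl⟩
  obtain ⟨κ, hκ⟩ : ∃ κ, κ = v * ((1 - q) / ((u : ℝ) - s) ^ 2) := ⟨_, rfl⟩
  have hexp := bridgeMean_sq_add_bridgeVariance (η := η) (θ := θ) s t u ha hb hv hκ
  -- `α`, `β`, `γ`, `δ`, `ε`, `v` are the coefficients of the conditional second moment of `X t`.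
  obtain ⟨α, hα⟩ : ∃ α, α = a ^ 2 + κ * u := ⟨_, rfl⟩
  obtain ⟨β, hβ⟩ : ∃ β, β = 2 * a * b - κ * (u + s) := ⟨_, rfl⟩
  obtain ⟨γ, hγ⟩ : ∃ γ, γ = b ^ 2 + κ * s := ⟨_, rfl⟩
  obtain ⟨δ, hδ⟩ : ∃ δ, δ = v * (η / ((u : ℝ) - s)) * u - v * (θ / ((u : ℝ) - s)) := ⟨_, rfl⟩
  obtain ⟨ε, hε⟩ : ∃ ε, ε = v * (θ / ((u : ℝ) - s)) - v * (η / ((u : ℝ) - s)) * s := ⟨_, rfl⟩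
  rw [← hα, ← hβ, ← hγ, ← hδ, ← hε] at hexp
  have hab : a + b = 1 := by rw [ha, hb]; field_simp; ring
  have hsum : α + β - a = b - γ := by
    have : α + β + γ = (a + b) ^ 2 := by rw [hα, hβ, hγ]; ring
    rw [hab] at this; linarith
  have hbγ : b - γ ≠ 0 := by
    have : b - γ = ((t : ℝ) - s) * (u - t) / ((u - s) * (u - q * s)) := by
      rw [hγ, hκ, hv, hb]
      obtain ⟨D, hD⟩ : ∃ D, D = (u : ℝ) - q * s := ⟨_, rfl⟩
      rw [← hD] at huqs ⊢
      have h1 := hus.ne'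
      have h2 := huqs.ne'
      field_simp
      linear_combination ((t : ℝ) - s) * (u - t) * hD
    rw [this]
    have h1 : (0 : ℝ) < t - s := by linarith
    have h2 : (0 : ℝ) < u - t := by linarith
    positivity
  refine ⟨Polynomial.C (b - γ)⁻¹ * (g₁ - g₂ + Polynomial.C α * (Polynomial.X ^ 2 * r₄)
    + Polynomial.C (β - a) * (Polynomial.X ^ 1 * r₃)
    + Polynomial.C δ * (Polynomial.X ^ 1 * (Polynomial.X ^ k + r₄))
    + Polynomial.C ε * (Polynomial.X ^ 0 * (Polynomial.X ^ (k + 1) + r₃))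
    + Polynomial.C v * (Polynomial.X ^ 0 * (Polynomial.X ^ k + r₄))), ?_, ?_⟩
  · have hX : ∀ (i : ℕ) (r : Polynomial ℝ), r.degree < i →
        (Polynomial.X ^ i + r).degree < ((i + 1 : ℕ) : WithBot ℕ) := by
      intro i r hr
      have hi : ((i : ℕ) : WithBot ℕ) < (i + 1 : ℕ) := by exact_mod_cast Nat.lt_succ_self i
      exact (Polynomial.degree_add_le _ _).trans_lt
        (max_lt ((Polynomial.degree_X_pow_le i).trans_lt hi) (hr.trans hi))
    rw [← Polynomial.mem_degreeLT]
    simp only [Polynomial.C_mul']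
    refine Submodule.smul_mem _ _ (add_mem (add_mem (add_mem (add_mem (add_mem (sub_mem
      (Polynomial.mem_degreeLT.2 hg₁) (Polynomial.mem_degreeLT.2 hg₂)) ?_) ?_) ?_) ?_) ?_)
    · exact Submodule.smul_mem _ _ (key _ 2 r₄ hr₄ (by omega))
    · exact Submodule.smul_mem _ _ (key _ 1 r₃ hr₃ (by omega))
    · exact Submodule.smul_mem _ _ (key _ 1 _ (hX k r₄ hr₄) (by omega))
    · exact Submodule.smul_mem _ _ (key _ 0 _ (hX (k + 1) r₃ hr₃) (by omega))
    · exact Submodule.smul_mem _ _ (key _ 0 _ (hX k r₄ hr₄) (by omega))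
  · intro L hL W hW
    have hWt : W ∈ supported ℝ (Set.Iic t) := supported_mono (Set.Iic_subset_Iic.2 hst.le) hW
    have hXt : (X t : MvPolynomial ℝ≥0 ℝ) ∈ supported ℝ (Set.Iic t) :=
      X_mem_supported.2 (Set.mem_Iic.2 le_rfl)
    have hXs : (X s : MvPolynomial ℝ≥0 ℝ) ∈ supported ℝ (Set.Iic s) :=
      X_mem_supported.2 (Set.mem_Iic.2 le_rfl)
    have hWu : W ∈ supported ℝ (Set.Iic s ∪ Set.Ici u) :=
      supported_mono Set.subset_union_left hW
    have hXu : (X u : MvPolynomial ℝ≥0 ℝ) ∈ supported ℝ (Set.Iic s ∪ Set.Ici u) :=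
      X_mem_supported.2 (Or.inr (Set.mem_Ici.2 le_rfl))
    have e₁ := h₁ L hL (X t * W) (mul_mem hXt hWt)
    have e₂ := h₂ L hL (X t ^ 2 * W) (mul_mem (pow_mem hXt 2) hWt)
    have e₃ := h₃ L hL (X s * W) (mul_mem hXs hW)
    have e₃' := h₃ L hL W hW
    have e₄ := h₄ L hL (X s ^ 2 * W) (mul_mem (pow_mem hXs 2) hW)
    have e₄' := h₄ L hL (X s * W) (mul_mem hXs hW)
    have e₄'' := h₄ L hL W hW
    have e₅ := h₅ L hL W hW
    have e₆ := h₆ L hL W hW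
    have e₇ := hL.harness s t u hst htu (X u ^ (k + 1) * W) (mul_mem (pow_mem hXu _) hWu)
    have e₈ := hL.quadratic s t u hst htu (X u ^ k * W) (mul_mem (pow_mem hXu _) hWu)
    rw [hexp] at e₈
    rw [bridgeMean, ← ha, ← hb] at e₇
    simp only [map_add, map_sub, map_mul, map_pow, Polynomial.aeval_X, Polynomial.aeval_C,
      algebraMap_eq, add_mul, sub_mul, mul_assoc, C_mul', smul_mul_assoc, map_smul, smul_eq_mul,
      pow_zero, one_mul, pow_one, mul_add, mul_sub]
      at e₁ e₂ e₃ e₃' e₄ e₄' e₄'' e₅ e₆ e₇ e₈ ⊢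
    -- bring all monomials to a common normal form
    have n₁ : (X u : MvPolynomial ℝ≥0 ℝ) ^ (k + 1) * (X t * W) = X t * (X u ^ (k + 1) * W) := by
      ring
    have n₂ : (X t : MvPolynomial ℝ≥0 ℝ) ^ (k + 1) * (X t * W) = X t ^ (k + 2) * W := by ring
    have n₃ : (X u : MvPolynomial ℝ≥0 ℝ) ^ k * (X t ^ 2 * W) = X t ^ 2 * (X u ^ k * W) := by ring
    have n₄ : (X t : MvPolynomial ℝ≥0 ℝ) ^ k * (X t ^ 2 * W) = X t ^ (k + 2) * W := by ring
    have n₅ : Polynomial.aeval (X t : MvPolynomial ℝ≥0 ℝ) r₁ * (X t * W)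
        = X t * (Polynomial.aeval (X t) r₁ * W) := by ring
    have n₆ : Polynomial.aeval (X t : MvPolynomial ℝ≥0 ℝ) r₂ * (X t ^ 2 * W)
        = X t ^ 2 * (Polynomial.aeval (X t) r₂ * W) := by ring
    have n₇ : (X u : MvPolynomial ℝ≥0 ℝ) * (X u ^ (k + 1) * W) = X u ^ (k + 2) * W := by ring
    have n₈ : (X u : MvPolynomial ℝ≥0 ℝ) ^ 2 * (X u ^ k * W) = X u ^ (k + 2) * W := by ring
    have n₉ : (X u : MvPolynomial ℝ≥0 ℝ) * (X u ^ k * W) = X u ^ (k + 1) * W := by ring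
    have n₁₀ : (X s : MvPolynomial ℝ≥0 ℝ) * (X u ^ (k + 1) * W) = X u ^ (k + 1) * (X s * W) := by
      ring
    have n₁₁ : (X s : MvPolynomial ℝ≥0 ℝ) ^ 2 * (X u ^ k * W) = X u ^ k * (X s ^ 2 * W) := by ring
    have n₁₂ : (X s : MvPolynomial ℝ≥0 ℝ) * (X u ^ k * W) = X u ^ k * (X s * W) := by ring
    have n₁₃ : (X s : MvPolynomial ℝ≥0 ℝ) ^ (k + 1) * (X s * W) = X s ^ (k + 2) * W := by ring
    have n₁₄ : (X s : MvPolynomial ℝ≥0 ℝ) ^ k * (X s ^ 2 * W) = X s ^ (k + 2) * W := by ring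
    have n₁₅ : (X s : MvPolynomial ℝ≥0 ℝ) * (X s ^ k * W) = X s ^ k * (X s * W) := by ring
    have n₁₆ : Polynomial.aeval (X s : MvPolynomial ℝ≥0 ℝ) r₃ * (X s * W)
        = X s * (Polynomial.aeval (X s) r₃ * W) := by ring
    have n₁₇ : Polynomial.aeval (X s : MvPolynomial ℝ≥0 ℝ) r₄ * (X s ^ 2 * W)
        = X s ^ 2 * (Polynomial.aeval (X s) r₄ * W) := by ring
    have n₁₈ : Polynomial.aeval (X s : MvPolynomial ℝ≥0 ℝ) r₄ * (X s * W)
        = X s * (Polynomial.aeval (X s) r₄ * W) := by ring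
    rw [n₁, n₂, n₅] at e₁
    rw [n₃, n₄, n₆] at e₂
    rw [n₁₃, n₁₆] at e₃
    rw [n₁₄, n₁₇] at e₄
    rw [n₁₈] at e₄'
    rw [n₇, n₁₀] at e₇
    rw [n₈, n₉, n₁₂, n₁₁, n₁₀] at e₈
    rw [n₁₅]
    rw [e₃] at e₇
    rw [e₃, e₃', e₄, e₄', e₄''] at e₈
    -- `e₁`, `e₅`, `e₇` and `e₂`, `e₆`, `e₈` express `b M` and `γ M`, `M = L (X_u ^ (k + 2) W)`, by
    -- `L (X_t ^ (k + 2) W)`, which cancels in the difference, and by moments of lower order.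
    have hc : (b - γ)⁻¹ * (b - γ) = 1 := inv_mul_cancel₀ hbγ
    linear_combination (b - γ)⁻¹ * (e₁ + e₅ - e₇ - e₂ - e₆ + e₈ + L (X s ^ (k + 2) * W) * hsum)
      - (L (X u ^ (k + 2) * W) - L (X s ^ (k + 2) * W)) * hc

lemma hasCondMoment (hq : q ≤ 1) (n : ℕ) : HasCondMoment η θ q n := by
  induction n using Nat.strong_induction_on with
  | _ n ih =>
    match n, ih with
    | 0, _ => exact hasCondMoment_zero
    | 1, _ => exact hasCondMoment_one
    | k + 2, ih => exact hasCondMoment_add_two hq ih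

lemma map_eq_map_of_mem_supported {L L' : MvPolynomial ℝ≥0 ℝ →ₗ[ℝ] ℝ} {A : Set ℝ≥0}
    (h : ∀ d : ℝ≥0 →₀ ℕ, (d.support : Set ℝ≥0) ⊆ A → L (monomial d 1) = L' (monomial d 1))
    {f : MvPolynomial ℝ≥0 ℝ} (hf : f ∈ supported ℝ A) : L f = L' f := by
  rw [f.as_sum, map_sum, map_sum]
  refine Finset.sum_congr rfl fun d hd => ?_
  have hd' : (d.support : Set ℝ≥0) ⊆ A := fun i hi =>
    mem_supported.1 hf (Finset.mem_coe.2 (mem_vars_iff_mem_support i |>.2 ⟨d, hd, hi⟩))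
  have h1 : (monomial d (coeff d f)) = coeff d f • (monomial d (1 : ℝ)) := by
    rw [smul_monomial, smul_eq_mul, mul_one]
  rw [h1, map_smul, map_smul, h d hd']

/-- The functional of mixed moments is determined by its parameters: the variable with the largest
index can be integrated out by means of the conditional moments. -/
theorem IsMomentFunctional.unique (hq : q ≤ 1) {L L' : MvPolynomial ℝ≥0 ℝ →ₗ[ℝ] ℝ}
    (hL : IsMomentFunctional η θ q L) (hL' : IsMomentFunctional η θ q L') : L = L' := by
  classical
  have hmul : ∀ (t : ℝ≥0) (d : ℝ≥0 →₀ ℕ), (monomial d (1 : ℝ)) =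
      X t ^ d t * monomial (d.erase t) 1 := by
    intro t d
    rw [X_pow_eq_monomial, monomial_mul, one_mul, Finsupp.single_add_erase]
  have main : ∀ S : Finset ℝ≥0, ∀ d : ℝ≥0 →₀ ℕ, (d.support : Set ℝ≥0) ⊆ insert 0 (S : Set ℝ≥0) →
      L (monomial d 1) = L' (monomial d 1) := by
    intro S
    refine Finset.induction_on_max S ?_ ?_
    · intro d hd
      rw [hmul 0 d]
      have he : d.erase 0 = 0 := by
        ext i
        by_cases hi : i = 0
        · simp [hi]
        · rw [Finsupp.erase_ne hi]
          by_contra h0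
          exact hi (by simpa using hd (Finset.mem_coe.2 (Finsupp.mem_support_iff.2 h0)))
      rw [he]
      rcases Nat.eq_zero_or_pos (d 0) with h0 | h0
      · rw [h0, pow_zero, one_mul]
        exact hL.map_one.trans hL'.map_one.symm
      · obtain ⟨k, hk⟩ := Nat.exists_eq_add_of_lt h0
        rw [hk, zero_add, pow_succ', mul_assoc, hL.map_X_zero_mul, hL'.map_X_zero_mul]
    · intro t S hS ih d hd
      rcases eq_or_ne t 0 with rfl | ht
      · exact ih d (by simpa using hd)
      have ht0 : 0 < t := pos_iff_ne_zero.2 ht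
      have hle : ∀ i ∈ insert 0 (S : Set ℝ≥0), i ≤ S.sup id := by
        rintro i (rfl | hi)
        · exact zero_le
        · exact Finset.le_sup (f := id) hi
      have hmem : S.sup id ∈ insert 0 (S : Set ℝ≥0) := by
        rcases S.eq_empty_or_nonempty with rfl | hne
        · simp
        · obtain ⟨i, hi, h⟩ := Finset.exists_mem_eq_sup S hne id
          rw [h]; exact Or.inr hi
      obtain ⟨r, -, hr⟩ := hasCondMoment (η := η) (θ := θ) hq (d t) (S.sup id) t
        ((Finset.sup_lt_iff ht0).2 hS)
      have hW : monomial (d.erase t) (1 : ℝ) ∈ supported ℝ (insert 0 (S : Set ℝ≥0)) := by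
        rw [mem_supported, vars_monomial one_ne_zero, Finsupp.support_erase]
        intro i hi
        rw [Finset.mem_coe, Finset.mem_erase] at hi
        rcases hd (Finset.mem_coe.2 hi.2) with h | h
        · exact Or.inl h
        · rcases Finset.mem_insert.1 (Finset.mem_coe.1 h) with h | h
          · exact absurd h hi.1
          · exact Or.inr h
      have hW' : monomial (d.erase t) (1 : ℝ) ∈ supported ℝ (Set.Iic (S.sup id)) :=
        supported_mono hle hW
      have e := hr L hL _ hW'
      have e' := hr L' hL' _ hW'
      rw [map_pow, Polynomial.aeval_X] at e e'
      rw [hmul t d, e, e']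
      refine map_eq_map_of_mem_supported ih (mul_mem ?_ hW)
      have hX : (X (S.sup id) : MvPolynomial ℝ≥0 ℝ) ∈ supported ℝ (insert 0 (S : Set ℝ≥0)) :=
        X_mem_supported.2 hmem
      have := Subalgebra.aeval_coe (supported ℝ (insert 0 (S : Set ℝ≥0))) ⟨_, hX⟩
        (Polynomial.X ^ d t + r)
      exact (congrArg (· ∈ supported ℝ (insert 0 (S : Set ℝ≥0))) this).mpr (SetLike.coe_mem _)
  refine LinearMap.ext fun f => map_eq_map_of_mem_supported (A := Set.univ)
    (fun d _ => main d.support d (Set.subset_insert _ _)) ?_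
  rw [supported_univ]
  trivial

end QuadraticHarness

/-! ### Conditional moments of bi-Poisson processes -/

namespace QuadraticHarness

open Filter Topology

lemma integral_mul_eq_of_condExp_ae_eq {Ω : Type*} {m m₀ : MeasurableSpace Ω} {P : Measure Ω}
    [IsFiniteMeasure P] (hm : m ≤ m₀) {Z Q W : Ω → ℝ} (hZ : Integrable Z P) (h : P[Z | m] =ᵐ[P] Q)
    (hW : AEStronglyMeasurable[m] W P) (hZW : Integrable (fun ω => Z ω * W ω) P) :
    ∫ ω, Z ω * W ω ∂P = ∫ ω, Q ω * W ω ∂P := by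
  have h1 : P[fun ω => Z ω * W ω | m] =ᵐ[P] fun ω => Q ω * W ω := by
    filter_upwards [condExp_mul_of_aestronglyMeasurable_right hW hZW hZ, h] with ω h1 h2
    rw [← h2]
    exact h1
  rw [← integral_condExp hm, integral_congr_ae h1]

lemma stronglyMeasurable_pastSigma {Ω : Type*} {X : ℝ≥0 → Ω → ℝ} {r s : ℝ≥0} (h : r ≤ s) :
    StronglyMeasurable[pastSigma X s] (X r) :=
  Measurable.stronglyMeasurable (Measurable.of_comap_le
    (le_iSup₂_of_le (f := fun r (_ : r ∈ {r : ℝ≥0 | r ≤ s}) =>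
      MeasurableSpace.comap (X r) inferInstance) r h le_rfl))

lemma stronglyMeasurable_pastFutureSigma {Ω : Type*} {X : ℝ≥0 → Ω → ℝ}
    {r s u : ℝ≥0} (h : r ≤ s ∨ u < r) :
    StronglyMeasurable[pastFutureSigma X s u] (X r) :=
  Measurable.stronglyMeasurable (Measurable.of_comap_le
    (le_iSup₂_of_le (f := fun r (_ : r ∈ {r : ℝ≥0 | r ≤ s ∨ u < r}) =>
      MeasurableSpace.comap (X r) inferInstance) r h le_rfl))

lemma pastSigma_le_pastFutureSigma {Ω : Type*} {X : ℝ≥0 → Ω → ℝ} (s u : ℝ≥0) :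
    pastSigma X s ≤ pastFutureSigma X s u :=
  biSup_mono fun _ hr => Or.inl hr

lemma tendsto_div_sub_atTop (c s : ℝ) :
    Tendsto (fun u : ℝ≥0 => c / ((u : ℝ) - s)) atTop (𝓝 0) :=
  tendsto_const_nhds.div_atTop
    (tendsto_atTop_add_const_right _ (-s) (NNReal.tendsto_coe_atTop.2 tendsto_id))

lemma tendsto_sub_div_sub_atTop (a s : ℝ) :
    Tendsto (fun u : ℝ≥0 => ((u : ℝ) - a) / ((u : ℝ) - s)) atTop (𝓝 1) := by
  have h := (tendsto_div_sub_atTop (s - a) s).const_add 1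
  rw [add_zero] at h
  refine h.congr' ?_
  filter_upwards [(NNReal.tendsto_coe_atTop.2 tendsto_id).eventually_gt_atTop s] with u hu
  have h0 : (u : ℝ) - s ≠ 0 := (sub_pos.2 hu).ne'
  field_simp
  ring

end QuadraticHarness

namespace IsBiPoisson

open Filter Topology QuadraticHarness

variable {Ω : Type*} [MeasurableSpace Ω] {P : Measure Ω}
  {η θ q : ℝ} {X : ℝ≥0 → Ω → ℝ}

lemma pastFutureSigma_le (hX : IsBiPoisson P η θ q X) (s u : ℝ≥0) :
    pastFutureSigma X s u ≤ ‹MeasurableSpace Ω› :=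
  iSup₂_le fun r _ => (hX.measurable r).comap_le

lemma pastSigma_le (hX : IsBiPoisson P η θ q X) (s : ℝ≥0) :
    pastSigma X s ≤ ‹MeasurableSpace Ω› :=
  iSup₂_le fun r _ => (hX.measurable r).comap_le

/-- Although `X u` need not be measurable with respect to `𝓕_{s,u}`, it is so up to a null set: the
harness property expresses it through `X s` and a conditional expectation. -/
lemma aestronglyMeasurable_pastFutureSigma (hX : IsBiPoisson P η θ q X) {r s u : ℝ≥0} (hsu : s < u)
    (h : r ≤ s ∨ u ≤ r) : AEStronglyMeasurable[pastFutureSigma X s u] (X r) P := by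
  rcases h with h | h
  · exact (stronglyMeasurable_pastFutureSigma (Or.inl h)).aestronglyMeasurable
  rcases h.lt_or_eq with h | rfl
  · exact (stronglyMeasurable_pastFutureSigma (Or.inr h)).aestronglyMeasurable
  obtain ⟨t, hst, htu⟩ := exists_between hsu
  have hst' : (s : ℝ) < t := hst
  have htu' : (t : ℝ) < u := htu
  have h1 : AEStronglyMeasurable[pastFutureSigma X s u]
      (fun ω => (((u : ℝ) - s) / (t - s)) *
        ((P[X t | pastFutureSigma X s u]) ω - ((u : ℝ) - t) / ((u : ℝ) - s) * X s ω)) P :=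
    ((stronglyMeasurable_condExp.sub
      ((stronglyMeasurable_pastFutureSigma (Or.inl le_rfl)).const_mul _)).const_mul
        _).aestronglyMeasurable
  refine h1.congr ?_
  filter_upwards [hX.harness s t u hst htu] with ω hω
  rw [hω]
  have h2 : (u : ℝ) - s ≠ 0 := by linarith
  have h3 : (t : ℝ) - s ≠ 0 := by linarith
  field_simp
  ring

lemma integrable_sq (hX : IsBiPoisson P η θ q X) (t : ℝ≥0) : Integrable (fun ω => X t ω ^ 2) P :=
  (hX.square_integrable t).integrable_sq

lemma integrable_mul (hX : IsBiPoisson P η θ q X) (s t : ℝ≥0) :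
    Integrable (fun ω => X s ω * X t ω) P :=
  (hX.square_integrable s).integrable_mul (hX.square_integrable t)

lemma integral_sq (hX : IsBiPoisson P η θ q X) (t : ℝ≥0) : ∫ ω, X t ω ^ 2 ∂P = t := by
  simpa [sq] using hX.covariance t t

lemma ae_zero (hX : IsBiPoisson P η θ q X) : X 0 =ᵐ[P] 0 := by
  have h := (integral_eq_zero_iff_of_nonneg (fun ω => sq_nonneg (X 0 ω)) (hX.integrable_sq 0)).1
    (by rw [hX.integral_sq 0, NNReal.coe_zero])
  filter_upwards [h] with ω hω
  simpa using hω

variable [IsProbabilityMeasure P]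

lemma integrable (hX : IsBiPoisson P η θ q X) (t : ℝ≥0) : Integrable (X t) P :=
  (hX.square_integrable t).integrable one_le_two

lemma condExp_sq (hX : IsBiPoisson P η θ q X) {s t u : ℝ≥0} (hst : s < t) (htu : t < u) :
    P[fun ω => X t ω ^ 2 | pastFutureSigma X s u] =ᵐ[P] fun ω =>
      (((u : ℝ) - t) / ((u : ℝ) - s) * X s ω + ((t : ℝ) - s) / ((u : ℝ) - s) * X u ω) ^ 2
      + ((u : ℝ) - t) * ((t : ℝ) - s) / ((u : ℝ) - q * s) *
        (1 + η * ((u * X s ω - s * X u ω) / ((u : ℝ) - s))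
          + θ * ((X u ω - X s ω) / ((u : ℝ) - s))
          - (1 - q) * ((u * X s ω - s * X u ω) * (X u ω - X s ω) / ((u : ℝ) - s) ^ 2)) := by
  filter_upwards [condVar_ae_eq_condExp_sq_sub_sq_condExp (hX.pastFutureSigma_le s u)
    (hX.square_integrable t), hX.harness s t u hst htu, hX.quadratic_variance s t u hst htu]
    with ω h1 h2 h3
  have h4 : (Var[X t; P | pastFutureSigma X s u]) ω =
    (P[X t ^ 2 | pastFutureSigma X s u]) ω - (P[X t | pastFutureSigma X s u]) ω ^ 2 := h1
  rw [h2, h3] at h4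
  change (P[X t ^ 2 | pastFutureSigma X s u]) ω = _
  rw [h4]
  ring

/-- If `q > 1`, the denominator `u - q s` vanishes for `s = 1`, `u = q`, so that, by the
convention `x / 0 = 0`, the conditional variance of `X_t` would be zero there, whereas its mean is
determined by the covariances. -/
lemma le_one (hX : IsBiPoisson P η θ q X) : q ≤ 1 := by
  by_contra! hq
  obtain ⟨u, hu⟩ : ∃ u : ℝ≥0, (u : ℝ) = q := ⟨⟨q, by linarith⟩, rfl⟩
  have h1u : (1 : ℝ≥0) < u := by rw [← NNReal.coe_lt_coe, hu]; exact hq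
  obtain ⟨t, h1t, htu⟩ := exists_between h1u
  have h := integral_condExp (μ := P) (f := fun ω => X t ω ^ 2) (hX.pastFutureSigma_le 1 u)
  rw [integral_congr_ae (hX.condExp_sq h1t htu), hX.integral_sq] at h
  obtain ⟨a, ha⟩ : ∃ a, a = ((u : ℝ) - t) / ((u : ℝ) - 1) := ⟨_, rfl⟩
  obtain ⟨b, hb⟩ : ∃ b, b = ((t : ℝ) - 1) / ((u : ℝ) - 1) := ⟨_, rfl⟩
  have h2 : (u : ℝ) - q * 1 = 0 := by rw [hu]; ring
  simp only [NNReal.coe_one, h2, div_zero, zero_mul, add_zero, ← ha, ← hb] at h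
  have h3 : ∫ ω, (a * X 1 ω + b * X u ω) ^ 2 ∂P = a ^ 2 + 2 * a * b + b ^ 2 * u := by
    have h4 : (fun ω => (a * X 1 ω + b * X u ω) ^ 2) = fun ω =>
        a ^ 2 * X 1 ω ^ 2 + 2 * a * b * (X u ω * X 1 ω) + b ^ 2 * X u ω ^ 2 := by
      ext ω; ring
    rw [h4, integral_add (((hX.integrable_sq 1).const_mul _).fun_add
      ((hX.integrable_mul u 1).const_mul _)) ((hX.integrable_sq u).const_mul _),
      integral_add ((hX.integrable_sq 1).const_mul _) ((hX.integrable_mul u 1).const_mul _),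
      integral_const_mul, integral_const_mul, integral_const_mul, hX.integral_sq, hX.integral_sq,
      hX.covariance, min_eq_right h1u.le, NNReal.coe_one]
    ring
  rw [h3] at h
  have h1t' : (1 : ℝ) < t := h1t
  have htu' : (t : ℝ) < u := htu
  have h0 : (u : ℝ) - 1 ≠ 0 := by linarith
  have h5 : (t : ℝ) - (a ^ 2 + 2 * a * b + b ^ 2 * u) = (u - t) * (t - 1) / (u - 1) := by
    rw [ha, hb]; field_simp; ring
  have h6 : 0 < ((u : ℝ) - t) * (t - 1) / (u - 1) := by
    have : 0 < (u : ℝ) - t := by linarith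
    have : 0 < (t : ℝ) - 1 := by linarith
    have : 0 < (u : ℝ) - 1 := by linarith
    positivity
  linarith

/-- A bi-Poisson process is a martingale: this is the limit `u → ∞` of the harness property. -/
lemma condExp_past (hX : IsBiPoisson P η θ q X) {s t : ℝ≥0} (hst : s < t) :
    P[X t | pastSigma X s] =ᵐ[P] X s := by
  refine (ae_eq_condExp_of_forall_setIntegral_eq (hX.pastSigma_le s) (hX.integrable t)
    (fun A _ _ => (hX.integrable s).integrableOn) (fun A hA _ => ?_)
    (stronglyMeasurable_pastSigma le_rfl).aestronglyMeasurable).symm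
  have hst' : (s : ℝ) < t := hst
  have key : ∀ u : ℝ≥0, t < u → ∫ ω in A, X t ω ∂P =
      ((u : ℝ) - t) / ((u : ℝ) - s) * ∫ ω in A, X s ω ∂P
        + ((t : ℝ) - s) / ((u : ℝ) - s) * ∫ ω in A, X u ω ∂P := by
    intro u htu
    rw [← integral_const_mul, ← integral_const_mul, ← integral_add
      ((hX.integrable s).integrableOn.const_mul _) ((hX.integrable u).integrableOn.const_mul _),
      ← setIntegral_condExp (hX.pastFutureSigma_le s u) (hX.integrable t)
        (pastSigma_le_pastFutureSigma s u A hA)]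
    exact setIntegral_congr_ae (hX.pastSigma_le s A hA)
      ((hX.harness s t u hst htu).mono fun ω hω _ => hω)
  have hbound : ∀ u : ℝ≥0, |∫ ω in A, X u ω ∂P| ≤ 1 + Real.sqrt u := by
    intro u
    have h1 : |∫ ω in A, X u ω ∂P| ≤ ∫ ω, |X u ω| ∂P :=
      (abs_integral_le_integral_abs).trans (setIntegral_le_integral (hX.integrable u).abs
        (ae_of_all _ fun ω => abs_nonneg _))
    have h2 : ∫ ω, |X u ω| ∂P ≤ ∫ ω, ((1 + Real.sqrt u) / 2
        + 1 / (2 * (1 + Real.sqrt u)) * X u ω ^ 2) ∂P := by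
      refine integral_mono (hX.integrable u).abs
        ((integrable_const _).add ((hX.integrable_sq u).const_mul _)) fun ω => ?_
      have h3 : 0 < 1 + Real.sqrt u := by positivity
      have h4 : (1 + Real.sqrt u) / 2 + 1 / (2 * (1 + Real.sqrt u)) * X u ω ^ 2 - |X u ω|
          = ((1 + Real.sqrt u) - |X u ω|) ^ 2 / (2 * (1 + Real.sqrt u)) := by
        rw [← sq_abs (X u ω)]
        field_simp
        ring
      have h5 : 0 ≤ ((1 + Real.sqrt u) - |X u ω|) ^ 2 / (2 * (1 + Real.sqrt u)) := by positivity
      change |X u ω| ≤ _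
      linarith
    rw [integral_add (integrable_const _) ((hX.integrable_sq u).const_mul _), integral_const_mul,
      hX.integral_sq, integral_const] at h2
    have h3 : 0 < 1 + Real.sqrt u := by positivity
    have h6 : 1 / (2 * (1 + Real.sqrt u)) * (u : ℝ) ≤ (1 + Real.sqrt u) / 2 := by
      rw [div_mul_eq_mul_div, div_le_div_iff₀ (by positivity) (by positivity)]
      nlinarith [Real.sq_sqrt (NNReal.coe_nonneg u), Real.sqrt_nonneg (u : ℝ)]
    simp only [probReal_univ, one_smul] at h2
    linarith
  have hlim : Tendsto (fun u : ℝ≥0 => ((t : ℝ) - s) / ((u : ℝ) - s) * ∫ ω in A, X u ω ∂P)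
      atTop (𝓝 0) := by
    -- The integral of `X_u` over `A` is of order `√u`; squaring gives a rational bound.
    have hsq : Tendsto (fun u : ℝ≥0 => 4 * ((t : ℝ) - s) ^ 2 / ((u : ℝ) - s)
        * (((u : ℝ) - 0) / ((u : ℝ) - s))) atTop (𝓝 0) := by
      simpa using (tendsto_div_sub_atTop (4 * ((t : ℝ) - s) ^ 2) s).mul
        (tendsto_sub_div_sub_atTop 0 s)
    have hsqrt := (Real.continuous_sqrt.tendsto 0).comp hsq
    rw [Real.sqrt_zero] at hsqrt
    refine squeeze_zero_norm' ?_ hsqrt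
    filter_upwards [eventually_gt_atTop (max 1 s)] with u hu
    have hu1 : (1 : ℝ) < u := (le_max_left _ _).trans_lt hu
    have hus : (s : ℝ) < u := (le_max_right 1 s).trans_lt hu
    have h0 : 0 < (u : ℝ) - s := by linarith
    have h1 : 0 < (t : ℝ) - s := by linarith
    refine Real.le_sqrt_of_sq_le ?_
    simp only [sub_zero]
    rw [Real.norm_eq_abs, sq_abs, mul_pow, ← sq_abs (∫ ω in A, X u ω ∂P)]
    have h2 : |∫ ω in A, X u ω ∂P| ^ 2 ≤ 4 * u := by
      have h3 : 1 ≤ Real.sqrt u := Real.one_le_sqrt.2 hu1.le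
      calc |∫ ω in A, X u ω ∂P| ^ 2 ≤ (2 * Real.sqrt u) ^ 2 :=
            pow_le_pow_left₀ (abs_nonneg _) ((hbound u).trans (by linarith)) 2
        _ = 4 * u := by rw [mul_pow, Real.sq_sqrt (NNReal.coe_nonneg u)]; norm_num
    calc (((t : ℝ) - s) / ((u : ℝ) - s)) ^ 2 * |∫ ω in A, X u ω ∂P| ^ 2
        ≤ (((t : ℝ) - s) / ((u : ℝ) - s)) ^ 2 * (4 * u) := by gcongr
      _ = _ := by field_simp
  have hlim' := ((tendsto_sub_div_sub_atTop t s).mul_const (∫ ω in A, X s ω ∂P)).add hlim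
  rw [one_mul, add_zero] at hlim'
  refine (tendsto_nhds_unique (hlim'.congr' ?_) tendsto_const_nhds)
  filter_upwards [eventually_gt_atTop t] with u hu
  exact (key u hu).symm

/-- The limit `u → ∞` of the formula for the conditional variance. -/
lemma condExp_sq_past (hX : IsBiPoisson P η θ q X) {s t : ℝ≥0} (hst : s < t) :
    P[fun ω => X t ω ^ 2 | pastSigma X s] =ᵐ[P]
      fun ω => X s ω ^ 2 + ((t : ℝ) - s) * (1 + η * X s ω) := by
  refine (ae_eq_condExp_of_forall_setIntegral_eq (hX.pastSigma_le s) (hX.integrable_sq t)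
    (fun A _ _ => ?_) (fun A hA _ => ?_) ?_).symm
  · exact ((hX.integrable_sq s).add (((integrable_const _).add
      ((hX.integrable s).const_mul _)).const_mul _)).integrableOn
  swap
  · have h := stronglyMeasurable_pastSigma (X := X) (le_refl s)
    exact ((h.pow 2).add ((stronglyMeasurable_const.add
      (h.const_mul η)).const_mul ((t : ℝ) - s))).aestronglyMeasurable
  have hst' : (s : ℝ) < t := hst
  have hs0 : (0 : ℝ) ≤ s := s.2
  have hq := hX.le_one
  have hA' := hX.pastSigma_le s A hA
  set I := ∫ ω in A, X s ω ^ 2 ∂P with hI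
  set J := ∫ ω in A, X s ω ∂P with hJ
  have hmart : ∀ u : ℝ≥0, s < u → ∫ ω in A, X u ω ∂P = J := by
    intro u hsu
    rw [← setIntegral_condExp (hX.pastSigma_le s) (hX.integrable u) hA]
    exact setIntegral_congr_ae hA' ((hX.condExp_past hsu).mono fun ω hω _ => hω)
  have hmart' : ∀ u : ℝ≥0, s < u → ∫ ω in A, X u ω * X s ω ∂P = I := by
    intro u hsu
    rw [← setIntegral_condExp (hX.pastSigma_le s) (hX.integrable_mul u s) hA]
    have h1 := condExp_mul_of_aestronglyMeasurable_right (μ := P)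
      (stronglyMeasurable_pastSigma (X := X) (le_refl s)).aestronglyMeasurable
      (hX.integrable_mul u s) (hX.integrable u)
    refine setIntegral_congr_ae hA' ?_
    filter_upwards [h1, hX.condExp_past hsu] with ω h1 h2 _
    refine h1.trans ?_
    rw [Pi.mul_apply, h2, sq]
  have key : ∀ u : ℝ≥0, t < u → ∫ ω in A, X t ω ^ 2 ∂P =
      I + (((u : ℝ) - t) / ((u : ℝ) - q * s)) * (((t : ℝ) - s) * (P.real A + η * J))
      + ((((t : ℝ) - s) / ((u : ℝ) - s)) ^ 2 + ((u : ℝ) - t) * ((t : ℝ) - s) / ((u : ℝ) - q * s)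
          * ((1 - q) * s / ((u : ℝ) - s) ^ 2)) * (∫ ω in A, X u ω ^ 2 ∂P - I) := by
    intro u htu
    have hsu := hst.trans htu
    have hsu' : (s : ℝ) < u := hsu
    have hus : (u : ℝ) - s ≠ 0 := by linarith
    rw [← setIntegral_condExp (hX.pastFutureSigma_le s u) (hX.integrable_sq t)
        (pastSigma_le_pastFutureSigma s u A hA)]
    obtain ⟨a, ha⟩ : ∃ a, a = ((u : ℝ) - t) / ((u : ℝ) - s) := ⟨_, rfl⟩
    obtain ⟨b, hb⟩ : ∃ b, b = ((t : ℝ) - s) / ((u : ℝ) - s) := ⟨_, rfl⟩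
    obtain ⟨v, hv⟩ : ∃ v, v = ((u : ℝ) - t) * ((t : ℝ) - s) / ((u : ℝ) - q * s) := ⟨_, rfl⟩
    obtain ⟨κ, hκ⟩ : ∃ κ, κ = v * ((1 - q) / ((u : ℝ) - s) ^ 2) := ⟨_, rfl⟩
    have h1 : ∫ ω in A, (P[fun ω => X t ω ^ 2 | pastFutureSigma X s u]) ω ∂P = ∫ ω in A,
        ((a ^ 2 + κ * u) * X s ω ^ 2 + (2 * a * b - κ * (u + s)) * (X u ω * X s ω)
        + (b ^ 2 + κ * s) * X u ω ^ 2
        + (v * (η / ((u : ℝ) - s)) * u - v * (θ / ((u : ℝ) - s))) * X s ω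
        + (v * (θ / ((u : ℝ) - s)) - v * (η / ((u : ℝ) - s)) * s) * X u ω + v) ∂P := by
      refine setIntegral_congr_ae hA' ((hX.condExp_sq hst htu).mono fun ω hω _ => ?_)
      rw [hω, ← ha, ← hb, ← hv, hκ]
      ring
    have i1 := ((hX.integrable_sq s).const_mul (a ^ 2 + κ * u)).restrict (s := A)
    have i2 := ((hX.integrable_mul u s).const_mul
      (2 * a * b - κ * (u + s))).restrict (s := A)
    have i3 := ((hX.integrable_sq u).const_mul (b ^ 2 + κ * s)).restrict (s := A)
    have i4 := ((hX.integrable s).const_mul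
      (v * (η / ((u : ℝ) - s)) * u - v * (θ / ((u : ℝ) - s)))).restrict (s := A)
    have i5 := ((hX.integrable u).const_mul
      (v * (θ / ((u : ℝ) - s)) - v * (η / ((u : ℝ) - s)) * s)).restrict (s := A)
    have i6 : Integrable (fun _ : Ω => v) (P.restrict A) := integrable_const _
    rw [h1, integral_add ((((i1.fun_add i2).fun_add i3).fun_add i4).fun_add i5) i6,
      integral_add (((i1.fun_add i2).fun_add i3).fun_add i4) i5,
      integral_add ((i1.fun_add i2).fun_add i3) i4,
      integral_add (i1.fun_add i2) i3, integral_add i1 i2]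
    simp only [integral_const_mul, setIntegral_const, smul_eq_mul]
    rw [hmart u hsu, hmart' u hsu, ← hI, ← hJ]
    have hab : a + b = 1 := by rw [ha, hb]; field_simp; ring
    have e1 : ((u : ℝ) - t) / ((u : ℝ) - q * s) * (((t : ℝ) - s) * (P.real A + η * J))
        = v * (P.real A + η * J) := by rw [hv]; ring
    have e2 : (1 - q) * s / ((u : ℝ) - s) ^ 2 = ((1 - q) / ((u : ℝ) - s) ^ 2) * s := by ring
    have e3 : v * (η / ((u : ℝ) - s)) * u - v * (θ / ((u : ℝ) - s)) +
        (v * (θ / ((u : ℝ) - s)) - v * (η / ((u : ℝ) - s)) * s) = v * η := by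
      field_simp; ring
    rw [e1, e2, ← hb, ← hv, ← mul_assoc, ← hκ]
    linear_combination J * e3 + I * (a + b + 1) * hab
  have hu1 : Tendsto (fun u : ℝ≥0 => ((((t : ℝ) - s) / ((u : ℝ) - s)) ^ 2
      + ((u : ℝ) - t) * ((t : ℝ) - s) / ((u : ℝ) - q * s)
          * ((1 - q) * s / ((u : ℝ) - s) ^ 2)) * (∫ ω in A, X u ω ^ 2 ∂P - I)) atTop (𝓝 0) := by
    have g1 : Tendsto (fun u : ℝ≥0 => (((t : ℝ) - s) ^ 2 / ((u : ℝ) - s)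
        + ((u : ℝ) - t) / ((u : ℝ) - q * s) * (((t : ℝ) - s) * ((1 - q) * s) / ((u : ℝ) - s)))
          * (((u : ℝ) - (-s)) / ((u : ℝ) - s))) atTop (𝓝 0) := by
      simpa using ((tendsto_div_sub_atTop (((t : ℝ) - s) ^ 2) s).add
        ((tendsto_sub_div_sub_atTop t (q * s)).mul
          (tendsto_div_sub_atTop (((t : ℝ) - s) * ((1 - q) * s)) s))).mul
        (tendsto_sub_div_sub_atTop (-s) s)
    refine squeeze_zero_norm' ?_ g1
    filter_upwards [eventually_gt_atTop t] with u hu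
    have hu' : (t : ℝ) < u := hu
    have h1 : 0 < (u : ℝ) - s := by linarith
    have h2 : 0 < (u : ℝ) - t := by linarith
    have h3 : 0 < (t : ℝ) - s := by linarith
    have h4 : 0 < (u : ℝ) - q * s := by nlinarith
    have h5 : 0 ≤ 1 - q := by linarith
    have h6 : ∀ r : ℝ≥0, 0 ≤ ∫ ω in A, X r ω ^ 2 ∂P ∧ ∫ ω in A, X r ω ^ 2 ∂P ≤ r := fun r =>
      ⟨integral_nonneg fun ω => sq_nonneg _, (setIntegral_le_integral (hX.integrable_sq r)
        (ae_of_all _ fun ω => sq_nonneg _)).trans (hX.integral_sq r).le⟩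
    have h7 : |∫ ω in A, X u ω ^ 2 ∂P - I| ≤ u - (-s) := by
      rw [abs_le]
      constructor <;> linarith [h6 u, h6 s]
    rw [Real.norm_eq_abs, abs_mul, abs_of_nonneg (by positivity)]
    calc _ ≤ ((((t : ℝ) - s) / ((u : ℝ) - s)) ^ 2
      + ((u : ℝ) - t) * ((t : ℝ) - s) / ((u : ℝ) - q * s)
          * ((1 - q) * s / ((u : ℝ) - s) ^ 2)) * (u - (-s)) := by gcongr
      _ = _ := by field_simp
  have hlim := (((tendsto_sub_div_sub_atTop t (q * s)).mul_const
    (((t : ℝ) - s) * (P.real A + η * J))).const_add I).add hu1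
  rw [one_mul, add_zero] at hlim
  have h9 : ∫ ω in A, (X s ω ^ 2 + ((t : ℝ) - s) * (1 + η * X s ω)) ∂P
      = I + ((t : ℝ) - s) * (P.real A + η * J) := by
    have i1 := (hX.integrable s).restrict (s := A)
    have i2 : Integrable (fun _ : Ω => (1 : ℝ)) (P.restrict A) := integrable_const _
    rw [integral_add (hX.integrable_sq s).restrict ((i2.fun_add (i1.const_mul η)).const_mul _),
      integral_const_mul, integral_add i2 (i1.const_mul η), integral_const_mul, setIntegral_const,
      smul_eq_mul, mul_one]
  rw [h9]
  refine (tendsto_nhds_unique (hlim.congr' ?_) tendsto_const_nhds)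
  filter_upwards [eventually_gt_atTop t] with u hu
  exact (key u hu).symm

end IsBiPoisson

/-! ### Exponential integrability -/

namespace QuadraticHarness


lemma abs_sinh_sub_sinh_le (x y : ℝ) :
    |Real.sinh y - Real.sinh x| ≤ (Real.cosh x + Real.cosh y) * |y - x| := by
  refine Convex.norm_image_sub_le_of_norm_deriv_le (f := Real.sinh) (s := Set.uIcc x y)
    (fun z _ => Real.differentiable_sinh z) (fun z hz => ?_) (convex_uIcc x y)
    Set.left_mem_uIcc Set.right_mem_uIcc
  rw [Real.deriv_sinh, Real.norm_eq_abs, abs_of_pos (Real.cosh_pos z)]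
  have hmax : |z| ≤ max |x| |y| := by
    rcases Set.mem_uIcc.1 hz with h | h
    · exact abs_le_max_abs_abs h.1 h.2
    · exact (abs_le_max_abs_abs h.1 h.2).trans_eq (max_comm _ _)
  rcases le_max_iff.1 hmax with h | h
  all_goals
    have := Real.cosh_le_cosh.2 h
    linarith [Real.cosh_pos x, Real.cosh_pos y]

lemma abs_cosh_sub_cosh_le {x y M : ℝ} (hx : |x| ≤ M) (hy : |y| ≤ M) :
    |Real.cosh y - Real.cosh x| ≤ Real.cosh M * |y - x| := by
  refine Convex.norm_image_sub_le_of_norm_deriv_le (f := Real.cosh) (s := Set.Icc (-M) M)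
    (fun z _ => Real.differentiable_cosh z) (fun z hz => ?_) (convex_Icc _ _)
    (abs_le.1 hx) (abs_le.1 hy)
  rw [Real.deriv_cosh, Real.norm_eq_abs, Real.abs_sinh]
  refine (Real.sinh_lt_cosh _).le.trans ?_
  rw [Real.cosh_le_cosh, abs_abs]
  exact (abs_le.2 hz).trans (le_abs_self M)

/-- The truncation of a real number to the interval `[-N, N]`. -/
noncomputable def truncate (N x : ℝ) : ℝ := max (-N) (min N x)

lemma abs_truncate_le {N : ℝ} (hN : 0 ≤ N) (x : ℝ) : |truncate N x| ≤ N :=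
  abs_le.2 ⟨le_max_left _ _, max_le (by linarith) (min_le_left _ _)⟩

lemma abs_truncate_sub_le (N x y : ℝ) : |truncate N y - truncate N x| ≤ |y - x| := by
  unfold truncate
  grind

lemma truncate_eq_self {N x : ℝ} (h : |x| ≤ N) : truncate N x = x := by
  obtain ⟨h1, h2⟩ := abs_le.1 h
  rw [truncate, min_eq_right h2, max_eq_right h1]

lemma abs_truncate_le_abs {N : ℝ} (hN : 0 ≤ N) (x : ℝ) : |truncate N x| ≤ |x| := by
  unfold truncate
  grind

lemma continuous_truncate (N : ℝ) : Continuous (truncate N) := by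
  unfold truncate
  fun_prop

lemma abs_mul_cosh_sub_one_le {N l : ℝ} (hN : 0 ≤ N) (hl : 0 ≤ l) (x : ℝ) :
    |x| * (Real.cosh (l * truncate N x) - 1) ≤ x * Real.sinh (l * truncate N x) := by
  have h1 : x * Real.sinh (l * truncate N x) = |x| * Real.sinh |l * truncate N x| := by
    rw [← Real.abs_sinh]
    rcases le_total 0 x with h | h
    · have : 0 ≤ l * truncate N x := mul_nonneg hl (by unfold truncate; grind)
      rw [abs_of_nonneg h, abs_of_nonneg (Real.sinh_nonneg_iff.2 this)]
    · have : l * truncate N x ≤ 0 :=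
        mul_nonpos_of_nonneg_of_nonpos hl (by unfold truncate; grind)
      rw [abs_of_nonpos h, abs_of_nonpos (Real.sinh_nonpos_iff.2 this)]
      ring
  rw [h1, ← Real.cosh_abs (l * truncate N x)]
  have h2 : Real.cosh |l * truncate N x| - 1 ≤ Real.sinh |l * truncate N x| := by
    have h3 := Real.cosh_sub_sinh |l * truncate N x|
    have h4 : Real.exp (-|l * truncate N x|) ≤ 1 :=
      Real.exp_le_one_iff.2 (neg_nonpos.2 (abs_nonneg _))
    linarith
  exact mul_le_mul_of_nonneg_left h2 (abs_nonneg x)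

lemma sub_mul_sinh_sub_sinh_le {l : ℝ} (hl : 0 ≤ l) (N x y : ℝ) :
    (y - x) * (Real.sinh (l * truncate N y) - Real.sinh (l * truncate N x)) ≤
      l * ((y - x) ^ 2 * Real.cosh (l * truncate N x)
        + (y - x) ^ 2 * Real.cosh (l * truncate N y)) := by
  have h1 := abs_sinh_sub_sinh_le (l * truncate N x) (l * truncate N y)
  have h2 : |l * truncate N y - l * truncate N x| ≤ l * |y - x| := by
    rw [← mul_sub, abs_mul, abs_of_nonneg hl]
    exact mul_le_mul_of_nonneg_left (abs_truncate_sub_le N x y) hl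
  have h3 : 0 ≤ Real.cosh (l * truncate N x) + Real.cosh (l * truncate N y) := by positivity
  calc (y - x) * (Real.sinh (l * truncate N y) - Real.sinh (l * truncate N x))
      ≤ |y - x| * |Real.sinh (l * truncate N y) - Real.sinh (l * truncate N x)| := by
        rw [← abs_mul]; exact le_abs_self _
    _ ≤ |y - x| * ((Real.cosh (l * truncate N x) + Real.cosh (l * truncate N y))
          * (l * |y - x|)) := by gcongr; exact h1.trans (by gcongr)
    _ = l * ((y - x) ^ 2 * Real.cosh (l * truncate N x)
        + (y - x) ^ 2 * Real.cosh (l * truncate N y)) := by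
        rw [← sq_abs (y - x)]; ring

end QuadraticHarness

namespace IsBiPoisson

open Filter Topology QuadraticHarness

variable {Ω : Type*} [MeasurableSpace Ω] {P : Measure Ω} [IsProbabilityMeasure P]
  {η θ q : ℝ} {X : ℝ≥0 → Ω → ℝ}

lemma integral_mul_past (hX : IsBiPoisson P η θ q X) {s t : ℝ≥0} (hst : s < t) {W : Ω → ℝ}
    (hW : AEStronglyMeasurable[pastSigma X s] W P) (hi : Integrable (fun ω => X t ω * W ω) P) :
    ∫ ω, X t ω * W ω ∂P = ∫ ω, X s ω * W ω ∂P :=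
  integral_mul_eq_of_condExp_ae_eq (hX.pastSigma_le s) (hX.integrable t) (hX.condExp_past hst) hW hi

lemma integral_sq_mul_past (hX : IsBiPoisson P η θ q X) {s t : ℝ≥0} (hst : s < t) {W : Ω → ℝ}
    (hW : AEStronglyMeasurable[pastSigma X s] W P)
    (hi : Integrable (fun ω => X t ω ^ 2 * W ω) P) :
    ∫ ω, X t ω ^ 2 * W ω ∂P = ∫ ω, (X s ω ^ 2 + ((t : ℝ) - s) * (1 + η * X s ω)) * W ω ∂P :=
  integral_mul_eq_of_condExp_ae_eq (hX.pastSigma_le s) (hX.integrable_sq t)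
    (hX.condExp_sq_past hst) hW hi

/-- As `X 0 = 0`, the harness property for the interval `(0, t)` gives the conditional mean of `X s`
given the process from time `t` on. -/
lemma integral_mul_future (hX : IsBiPoisson P η θ q X) {s t : ℝ≥0} (hs : 0 < s) (hst : s < t)
    {W : Ω → ℝ} (hW : AEStronglyMeasurable[pastFutureSigma X 0 t] W P)
    (hi : Integrable (fun ω => X s ω * W ω) P) :
    ∫ ω, X s ω * W ω ∂P = ∫ ω, ((s : ℝ) / t * X t ω) * W ω ∂P := by
  refine integral_mul_eq_of_condExp_ae_eq (hX.pastFutureSigma_le 0 t) (hX.integrable s) ?_ hW hi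
  filter_upwards [hX.harness 0 s t hs hst, hX.ae_zero] with ω h h0
  rw [h, h0]
  simp

lemma integral_sq_mul_future (hX : IsBiPoisson P η θ q X) {s t : ℝ≥0} (hs : 0 < s) (hst : s < t)
    {W : Ω → ℝ} (hW : AEStronglyMeasurable[pastFutureSigma X 0 t] W P)
    (hi : Integrable (fun ω => X s ω ^ 2 * W ω) P) :
    ∫ ω, X s ω ^ 2 * W ω ∂P =
      ∫ ω, (((s : ℝ) / t * X t ω) ^ 2
        + ((t : ℝ) - s) * s / t * (1 + θ * (X t ω / t))) * W ω ∂P := by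
  refine integral_mul_eq_of_condExp_ae_eq (hX.pastFutureSigma_le 0 t) (hX.integrable_sq s) ?_ hW hi
  filter_upwards [hX.condExp_sq hs hst, hX.ae_zero] with ω h h0
  rw [h, h0]
  simp

/-- The second moment of an increment, weighted by a bounded function of its left end point. -/
lemma integral_sub_sq_mul_past (hX : IsBiPoisson P η θ q X) {s t : ℝ≥0} (hst : s < t) {g : ℝ → ℝ}
    (hg : Continuous g) {G : ℝ} (hG : ∀ x, ‖g x‖ ≤ G) :
    ∫ ω, (X t ω - X s ω) ^ 2 * g (X s ω) ∂P =
      ((t : ℝ) - s) * ∫ ω, (1 + η * X s ω) * g (X s ω) ∂P := by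
  have hsm := (stronglyMeasurable_pastSigma (X := X) (le_refl s)).aestronglyMeasurable (μ := P)
  have hm : AEStronglyMeasurable[pastSigma X s] (fun ω => g (X s ω)) P :=
    hg.comp_aestronglyMeasurable hsm
  have hm' : AEStronglyMeasurable (fun ω => g (X s ω)) P :=
    (hg.measurable.comp (hX.measurable s)).aestronglyMeasurable
  have hb : ∀ {Z : Ω → ℝ}, Integrable Z P → Integrable (fun ω => Z ω * g (X s ω)) P := fun hZ =>
    hZ.mul_bdd hm' (ae_of_all _ fun ω => hG (X s ω))
  have e1 := hX.integral_sq_mul_past hst hm (hb (hX.integrable_sq t))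
  have i2 : Integrable (fun ω => X t ω * (X s ω * g (X s ω))) P := by
    simpa only [mul_assoc] using hb (hX.integrable_mul t s)
  have e2 := hX.integral_mul_past hst (hsm.mul hm) i2
  have i3 : Integrable (fun ω => X s ω * (X s ω * g (X s ω))) P := by
    simpa only [mul_assoc] using hb (hX.integrable_mul s s)
  have i1 := hb (((integrable_const 1).fun_add ((hX.integrable s).const_mul η)))
  have h1 : (fun ω => (X t ω - X s ω) ^ 2 * g (X s ω)) = fun ω =>
      X t ω ^ 2 * g (X s ω) + (-2) * (X t ω * (X s ω * g (X s ω))) + X s ω ^ 2 * g (X s ω) := by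
    ext ω; ring
  have h2 : (fun ω => (X s ω ^ 2 + ((t : ℝ) - s) * (1 + η * X s ω)) * g (X s ω)) = fun ω =>
      X s ω ^ 2 * g (X s ω) + ((t : ℝ) - s) * ((1 + η * X s ω) * g (X s ω)) := by
    ext ω; ring
  rw [h2, integral_add (hb (hX.integrable_sq s)) (i1.const_mul _), integral_const_mul] at e1
  have h3 : ∫ ω, X s ω * (X s ω * g (X s ω)) ∂P = ∫ ω, X s ω ^ 2 * g (X s ω) ∂P :=
    integral_congr_ae (ae_of_all _ fun ω => by ring)
  rw [h1, integral_add ((hb (hX.integrable_sq t)).fun_add (i2.const_mul (-2)))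
    (hb (hX.integrable_sq s)), integral_add (hb (hX.integrable_sq t)) (i2.const_mul (-2)),
    integral_const_mul, e1]
  simp only [Pi.mul_apply] at e2
  rw [e2, h3]
  ring

/-- The second moment of an increment, weighted by a bounded function of its right end point. -/
lemma integral_sub_sq_mul_future (hX : IsBiPoisson P η θ q X) {s t : ℝ≥0} (hs : 0 < s)
    (hst : s < t) {g : ℝ → ℝ} (hg : Continuous g) {G : ℝ} (hG : ∀ x, ‖g x‖ ≤ G) :
    ∫ ω, (X t ω - X s ω) ^ 2 * g (X t ω) ∂P =
      (((t : ℝ) - s) / t) ^ 2 * ∫ ω, X t ω ^ 2 * g (X t ω) ∂P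
      + ((t : ℝ) - s) * s / t * ∫ ω, (1 + θ * (X t ω / t)) * g (X t ω) ∂P := by
  have ht : (0 : ℝ) < t := hs.trans hst
  have hsm := hX.aestronglyMeasurable_pastFutureSigma (hs.trans hst) (Or.inr (le_refl t))
  have hm : AEStronglyMeasurable[pastFutureSigma X 0 t] (fun ω => g (X t ω)) P :=
    hg.comp_aestronglyMeasurable hsm
  have hm' : AEStronglyMeasurable (fun ω => g (X t ω)) P :=
    (hg.measurable.comp (hX.measurable t)).aestronglyMeasurable
  have hb : ∀ {Z : Ω → ℝ}, Integrable Z P → Integrable (fun ω => Z ω * g (X t ω)) P := fun hZ =>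
    hZ.mul_bdd hm' (ae_of_all _ fun ω => hG (X t ω))
  have e1 := hX.integral_sq_mul_future hs hst hm (hb (hX.integrable_sq s))
  have i2 : Integrable (fun ω => X s ω * (X t ω * g (X t ω))) P := by
    simpa only [mul_assoc] using hb (hX.integrable_mul s t)
  have e2 := hX.integral_mul_future hs hst (hsm.mul hm) i2
  have i1 := hb (((integrable_const 1).fun_add (((hX.integrable t).div_const t).const_mul θ)))
  have h1 : (fun ω => (X t ω - X s ω) ^ 2 * g (X t ω)) = fun ω =>
      X t ω ^ 2 * g (X t ω) + (-2) * (X s ω * (X t ω * g (X t ω))) + X s ω ^ 2 * g (X t ω) := by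
    ext ω; ring
  have h2 : (fun ω => (((s : ℝ) / t * X t ω) ^ 2
      + ((t : ℝ) - s) * s / t * (1 + θ * (X t ω / t))) * g (X t ω)) = fun ω =>
      ((s : ℝ) / t) ^ 2 * (X t ω ^ 2 * g (X t ω))
        + ((t : ℝ) - s) * s / t * ((1 + θ * (X t ω / t)) * g (X t ω)) := by
    ext ω; ring
  rw [h2, integral_add ((hb (hX.integrable_sq t)).const_mul _) (i1.const_mul _),
    integral_const_mul, integral_const_mul] at e1
  have h3 : ∫ ω, (s : ℝ) / t * X t ω * (X t ω * g (X t ω)) ∂P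
      = (s : ℝ) / t * ∫ ω, X t ω ^ 2 * g (X t ω) ∂P := by
    rw [← integral_const_mul]
    exact integral_congr_ae (ae_of_all _ fun ω => by ring)
  rw [h1, integral_add ((hb (hX.integrable_sq t)).fun_add (i2.const_mul (-2)))
    (hb (hX.integrable_sq s)), integral_add (hb (hX.integrable_sq t)) (i2.const_mul (-2)),
    integral_const_mul, e1]
  simp only [Pi.mul_apply] at e2
  rw [e2, h3]
  field_simp
  ring

/-- The covariance of an increment and the increment of a bounded function of the process. -/
lemma integral_sub_mul_sub (hX : IsBiPoisson P η θ q X) {s t : ℝ≥0} (hs : 0 < s)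
    (hst : s < t) {f : ℝ → ℝ} (hf : Continuous f) {G : ℝ} (hG : ∀ x, ‖f x‖ ≤ G) :
    ∫ ω, (X t ω - X s ω) * (f (X t ω) - f (X s ω)) ∂P =
      ((t : ℝ) - s) / t * ∫ ω, X t ω * f (X t ω) ∂P := by
  have ht : (0 : ℝ) < t := hs.trans hst
  have hb : ∀ r v, Integrable (fun ω => X r ω * f (X v ω)) P := fun r v =>
    (hX.integrable r).mul_bdd (hf.measurable.comp (hX.measurable v)).aestronglyMeasurable
      (ae_of_all _ fun ω => hG (X v ω))
  have e1 := hX.integral_mul_future hs hst (W := fun ω => f (X t ω))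
    (hf.comp_aestronglyMeasurable
      (hX.aestronglyMeasurable_pastFutureSigma (hs.trans hst) (Or.inr (le_refl t)))) (hb s t)
  have e2 := hX.integral_mul_past hst (W := fun ω => f (X s ω)) (hf.comp_aestronglyMeasurable
    (stronglyMeasurable_pastSigma (le_refl s)).aestronglyMeasurable) (hb t s)
  have h1 : (fun ω => (X t ω - X s ω) * (f (X t ω) - f (X s ω))) = fun ω =>
      (X t ω * f (X t ω) + (-1) * (X s ω * f (X t ω)))
        + ((-1) * (X t ω * f (X s ω)) + X s ω * f (X s ω)) := by
    ext ω; ring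
  rw [h1, integral_add ((hb t t).fun_add ((hb s t).const_mul _))
    (((hb t s).const_mul _).fun_add (hb s s)), integral_add (hb t t) ((hb s t).const_mul _),
    integral_add ((hb t s).const_mul _) (hb s s), integral_const_mul, integral_const_mul, e1, e2]
  simp only [mul_assoc, integral_const_mul]
  field_simp
  ring

/-- The process is continuous in mean square, so that the expectation of `(1 + η X_s) g(X_s)` is
Hölder continuous from the left in `s` for bounded Lipschitz `g`. -/
lemma exists_integral_le_add_sqrt (hX : IsBiPoisson P η θ q X) (t : ℝ≥0) {g : ℝ → ℝ} {G K : ℝ}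
    (hgc : Continuous g) (hgG : ∀ x, ‖g x‖ ≤ G) (hglip : ∀ x y, |g y - g x| ≤ K * |y - x|) :
    ∃ C, ∀ s < t, ∫ ω, (1 + η * X s ω) * g (X s ω) ∂P
      ≤ ∫ ω, (1 + η * X t ω) * g (X t ω) ∂P + Real.sqrt (t - s) * C := by
  have i1 : ∀ r, Integrable (fun ω => (1 + η * X r ω) * g (X r ω)) P := fun r =>
    ((integrable_const 1).fun_add ((hX.integrable r).const_mul η)).mul_bdd
      (hgc.measurable.comp (hX.measurable r)).aestronglyMeasurable
      (ae_of_all _ fun ω => hgG (X r ω))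
  obtain ⟨B, hB⟩ : ∃ B : ℝ → ℝ, B = fun y => |η| * G + K * (1 + |η| * |y|) := ⟨_, rfl⟩
  have hBi : Integrable (fun ω => B (X t ω) ^ 2) P := by
    have h1 : MemLp (fun ω => B (X t ω)) 2 P := by
      rw [hB]
      have h2 : MemLp (fun ω => 1 + |η| * |X t ω|) 2 P :=
        (memLp_const (1 : ℝ)).add ((hX.square_integrable t).abs.const_mul |η|)
      exact (memLp_const (|η| * G)).add (h2.const_mul K)
    exact h1.integrable_sq
  refine ⟨(∫ ω, B (X t ω) ^ 2 ∂P + 1) / 2, ?_⟩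
  intro s hst
  have hst' : (s : ℝ) < t := hst
  have hpos : 0 < Real.sqrt (t - s) := Real.sqrt_pos.2 (by linarith)
  have isq : Integrable (fun ω => (X t ω - X s ω) ^ 2) P :=
    ((hX.square_integrable t).sub (hX.square_integrable s)).integrable_sq
  have hle : ∀ ω, (1 + η * X s ω) * g (X s ω) ≤ (1 + η * X t ω) * g (X t ω)
      + (Real.sqrt (t - s) / 2 * B (X t ω) ^ 2
        + 1 / (2 * Real.sqrt (t - s)) * (X t ω - X s ω) ^ 2) := by
    intro ω
    have h1 : (1 + η * X s ω) * g (X s ω) - (1 + η * X t ω) * g (X t ω)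
        ≤ |X t ω - X s ω| * B (X t ω) := by
      have e : (1 + η * X s ω) * g (X s ω) - (1 + η * X t ω) * g (X t ω)
        = η * (X s ω - X t ω) * g (X s ω) + (1 + η * X t ω) * (g (X s ω) - g (X t ω)) := by ring
      rw [e]
      refine (le_abs_self _).trans ((abs_add_le _ _).trans ?_)
      rw [abs_mul, abs_mul, abs_mul, abs_sub_comm (X s ω), abs_sub_comm (g (X s ω))]
      have h2 : |1 + η * X t ω| ≤ 1 + |η| * |X t ω| := by
        refine (abs_add_le _ _).trans ?_
        rw [abs_one, abs_mul]
      calc |η| * |X t ω - X s ω| * |g (X s ω)| + |1 + η * X t ω| * |g (X t ω) - g (X s ω)|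
          ≤ |η| * |X t ω - X s ω| * G
            + (1 + |η| * |X t ω|) * (K * |X t ω - X s ω|) := by
            gcongr
            · exact hgG _
            · exact hglip _ _
        _ = |X t ω - X s ω| * B (X t ω) := by rw [hB]; ring
    -- Young's inequality with a weight that balances `E (X_t - X_s)² = t - s`
    have h2 : Real.sqrt (t - s) / 2 * B (X t ω) ^ 2
        + 1 / (2 * Real.sqrt (t - s)) * (X t ω - X s ω) ^ 2 - |X t ω - X s ω| * B (X t ω)
        = (Real.sqrt (t - s) * B (X t ω) - |X t ω - X s ω|) ^ 2 / (2 * Real.sqrt (t - s)) := by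
      rw [← sq_abs (X t ω - X s ω)]
      field_simp
      ring
    have h3 : 0 ≤ (Real.sqrt (t - s) * B (X t ω) - |X t ω - X s ω|) ^ 2
        / (2 * Real.sqrt (t - s)) := by positivity
    linarith
  have hint := integral_mono (i1 s) ((i1 t).fun_add ((hBi.const_mul _).fun_add
    (isq.const_mul _))) hle
  have hinc : ∫ ω, (X t ω - X s ω) ^ 2 ∂P = t - s := by
    have h1 : (fun ω => (X t ω - X s ω) ^ 2) = fun ω =>
        X t ω ^ 2 + (-2) * (X t ω * X s ω) + X s ω ^ 2 := by ext ω; ring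
    rw [h1, integral_add ((hX.integrable_sq t).fun_add ((hX.integrable_mul t s).const_mul _))
      (hX.integrable_sq s), integral_add (hX.integrable_sq t)
      ((hX.integrable_mul t s).const_mul _), integral_const_mul, hX.integral_sq, hX.integral_sq,
      hX.covariance, min_eq_right hst.le]
    ring
  rw [integral_add (i1 t) ((hBi.const_mul _).fun_add (isq.const_mul _)),
    integral_add (hBi.const_mul _) (isq.const_mul _), integral_const_mul, integral_const_mul,
    hinc] at hint
  refine hint.trans (le_of_eq ?_)
  have h4 : 1 / (2 * Real.sqrt (t - s)) * ((t : ℝ) - s) = Real.sqrt (t - s) / 2 := by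
    have h5 : (t : ℝ) - s = Real.sqrt (t - s) ^ 2 := (Real.sq_sqrt (by linarith)).symm
    rw [div_mul_eq_mul_div, one_mul, div_eq_div_iff (by positivity) (by positivity)]
    nlinarith
  rw [h4]
  ring

/-- The expectation of `X_t sinh(l X_t)`, with the argument of `sinh` truncated, is bounded by a
multiple of `l`. The factors `(X_t - X_s)²` that arise from the mean value theorem have conditional
expectations of order `t - s` both given the past of `s` and given the future of `t`; dividing by
`t - s` and letting `s → t` gives the bound. -/
lemma integral_mul_sinh_le (hX : IsBiPoisson P η θ q X) {t : ℝ≥0} (ht : 0 < t) {N l : ℝ}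
    (hN : 0 ≤ N) (hl : 0 ≤ l) :
    ∫ ω, X t ω * Real.sinh (l * truncate N (X t ω)) ∂P ≤
      l * t * (∫ ω, (1 + η * X t ω) * Real.cosh (l * truncate N (X t ω)) ∂P
        + ∫ ω, (1 + θ * (X t ω / t)) * Real.cosh (l * truncate N (X t ω)) ∂P) := by
  have ht' : (0 : ℝ) < t := ht
  obtain ⟨g, hg⟩ : ∃ g : ℝ → ℝ, g = fun x => Real.cosh (l * truncate N x) := ⟨_, rfl⟩
  obtain ⟨f, hf⟩ : ∃ f : ℝ → ℝ, f = fun x => Real.sinh (l * truncate N x) := ⟨_, rfl⟩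
  obtain ⟨G, hG⟩ : ∃ G : ℝ, G = Real.cosh (l * N) := ⟨_, rfl⟩
  have hc : Continuous fun x => l * truncate N x := (continuous_truncate N).const_mul l
  have hgc : Continuous g := hg ▸ Real.continuous_cosh.comp hc
  have hfc : Continuous f := hf ▸ Real.continuous_sinh.comp hc
  have hlN : ∀ x, |l * truncate N x| ≤ l * N := fun x => by
    rw [abs_mul, abs_of_nonneg hl]
    exact mul_le_mul_of_nonneg_left (abs_truncate_le hN x) hl
  have hgG : ∀ x, ‖g x‖ ≤ G := fun x => by
    rw [hg, hG, Real.norm_eq_abs, abs_of_pos (Real.cosh_pos _), Real.cosh_le_cosh]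
    exact (hlN x).trans (le_abs_self _)
  have hfG : ∀ x, ‖f x‖ ≤ G := fun x => by
    rw [hf, hG, Real.norm_eq_abs, Real.abs_sinh]
    refine (Real.sinh_lt_cosh _).le.trans ?_
    rw [Real.cosh_le_cosh, abs_abs]
    exact (hlN x).trans (le_abs_self _)
  have hG0 : 0 ≤ G := hG ▸ (Real.cosh_pos _).le
  have hglip : ∀ x y, |g y - g x| ≤ G * l * |y - x| := fun x y => by
    have h1 := abs_cosh_sub_cosh_le (hlN x) (hlN y)
    rw [← mul_sub, abs_mul, abs_of_nonneg hl, ← hG] at h1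
    rw [hg]
    refine h1.trans ?_
    rw [mul_assoc]
    exact mul_le_mul_of_nonneg_left
      (mul_le_mul_of_nonneg_left (abs_truncate_sub_le N x y) hl) hG0
  have hb : ∀ {Z : Ω → ℝ} (r : ℝ≥0), Integrable Z P →
      Integrable (fun ω => Z ω * g (X r ω)) P := fun r hZ =>
    hZ.mul_bdd (hgc.measurable.comp (hX.measurable r)).aestronglyMeasurable
      (ae_of_all _ fun ω => hgG (X r ω))
  obtain ⟨E₁, hE₁⟩ : ∃ E, E = ∫ ω, (1 + η * X t ω) * g (X t ω) ∂P := ⟨_, rfl⟩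
  obtain ⟨E₂, hE₂⟩ : ∃ E, E = ∫ ω, X t ω ^ 2 * g (X t ω) ∂P := ⟨_, rfl⟩
  obtain ⟨E₃, hE₃⟩ : ∃ E, E = ∫ ω, (1 + θ * (X t ω / t)) * g (X t ω) ∂P := ⟨_, rfl⟩
  obtain ⟨C, hcont⟩ := hX.exists_integral_le_add_sqrt t hgc hgG hglip
  rw [← hE₁] at hcont
  have key : ∀ s : ℝ≥0, 0 < s → s < t → ∫ ω, X t ω * f (X t ω) ∂P ≤
      l * t * (E₁ + Real.sqrt (t - s) * C + ((t : ℝ) - s) / t ^ 2 * E₂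
        + (s : ℝ) / t * E₃) := by
    intro s hs hst
    have hst' : (0 : ℝ) < (t : ℝ) - s := sub_pos.2 hst
    have isq : Integrable (fun ω => (X t ω - X s ω) ^ 2) P :=
      ((hX.square_integrable t).sub (hX.square_integrable s)).integrable_sq
    have hle := integral_mono (μ := P) (f := fun ω => (X t ω - X s ω) * (f (X t ω) - f (X s ω)))
      (g := fun ω => l * ((X t ω - X s ω) ^ 2 * g (X s ω) + (X t ω - X s ω) ^ 2 * g (X t ω)))
      (((hX.integrable t).sub (hX.integrable s)).mul_bdd (c := G + G)
        (((hfc.measurable.comp (hX.measurable t)).sub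
          (hfc.measurable.comp (hX.measurable s))).aestronglyMeasurable)
        (ae_of_all _ fun ω => (norm_sub_le _ _).trans (add_le_add (hfG _) (hfG _))))
      (((hb s isq).fun_add (hb t isq)).const_mul l)
      (fun ω => by
        rw [hf, hg]
        exact sub_mul_sinh_sub_sinh_le hl N (X s ω) (X t ω))
    rw [hX.integral_sub_mul_sub hs hst hfc hfG, integral_const_mul,
      integral_add (hb s isq) (hb t isq), hX.integral_sub_sq_mul_past hst hgc hgG,
      hX.integral_sub_sq_mul_future hs hst hgc hgG, ← hE₂, ← hE₃] at hle
    have h1 := hcont s hst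
    have h2 : ((t : ℝ) - s) / t * ∫ ω, X t ω * f (X t ω) ∂P ≤ ((t : ℝ) - s) / t *
        (l * t * (E₁ + Real.sqrt (t - s) * C + ((t : ℝ) - s) / t ^ 2 * E₂
        + (s : ℝ) / t * E₃)) := by
      refine hle.trans ?_
      calc _ ≤ l * (((t : ℝ) - s) * (E₁ + Real.sqrt (t - s) * C)
          + ((((t : ℝ) - s) / t) ^ 2 * E₂ + ((t : ℝ) - s) * s / t * E₃)) := by gcongr
        _ = _ := by field_simp; ring
    exact le_of_mul_le_mul_left h2 (by positivity)
  have hlim : Tendsto (fun h : ℝ => l * t * (E₁ + Real.sqrt h * C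
      + h / t ^ 2 * E₂ + (t - h) / t * E₃)) (𝓝[>] 0) (𝓝 (l * t * (E₁ + E₃))) := by
    have hcts : Continuous (fun h : ℝ => l * t * (E₁ + Real.sqrt h * C
      + h / t ^ 2 * E₂ + (t - h) / t * E₃)) := by fun_prop
    have h1 := (hcts.tendsto 0).mono_left (nhdsWithin_le_nhds (s := Set.Ioi 0))
    simpa [div_self ht'.ne'] using h1
  have hfin : ∫ ω, X t ω * f (X t ω) ∂P ≤ l * t * (E₁ + E₃) := by
    refine ge_of_tendsto hlim ?_
    filter_upwards [Ioo_mem_nhdsGT ht'] with h hh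
    obtain ⟨s, hs⟩ : ∃ s : ℝ≥0, (s : ℝ) = t - h := ⟨⟨t - h, by linarith [hh.2]⟩, rfl⟩
    have hk := key s (by rw [← NNReal.coe_pos, hs]; linarith [hh.2])
      (by rw [← NNReal.coe_lt_coe, hs]; linarith [hh.1])
    rwa [hs, sub_sub_cancel] at hk
  rwa [hE₁, hE₃, hf, hg] at hfin

/-- A bound on truncated exponential moments that is uniform in the truncation level `N`. -/
lemma exists_integral_cosh_truncate_le (hX : IsBiPoisson P η θ q X) {t : ℝ≥0} (ht : 0 < t) :
    ∃ l > 0, ∃ C, ∀ N ≥ 0, Integrable (fun ω => Real.cosh (l * truncate N (X t ω))) P ∧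
      ∫ ω, Real.cosh (l * truncate N (X t ω)) ∂P ≤ C := by
  have ht' : (0 : ℝ) < t := ht
  obtain ⟨κ, hκ⟩ : ∃ κ, κ = |η| + |θ| / t := ⟨_, rfl⟩
  have hκ0 : 0 ≤ κ := by rw [hκ]; positivity
  obtain ⟨l, hl⟩ : ∃ l : ℝ, l = 1 / (4 * t * (2 + κ)) := ⟨_, rfl⟩
  have hl0 : 0 < l := by rw [hl]; positivity
  have hlt : l * t * (2 + κ) = 1 / 4 := by rw [hl]; field_simp
  -- For this `l`, `integral_mul_sinh_le` bounds `A = E(|X_t| cosh)` by `E|X_t|`, a constant and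
  -- `A / 4`, and the last term can be absorbed.
  refine ⟨l, hl0, 3 * ∫ ω, |X t ω| ∂P + 3 * Real.cosh l, fun N hN => ?_⟩
  have hgm : AEStronglyMeasurable (fun ω => Real.cosh (l * truncate N (X t ω))) P :=
    (Real.continuous_cosh.comp ((continuous_truncate N).const_mul l)).measurable.comp
      (hX.measurable t) |>.aestronglyMeasurable
  have hfm : AEStronglyMeasurable (fun ω => Real.sinh (l * truncate N (X t ω))) P :=
    (Real.continuous_sinh.comp ((continuous_truncate N).const_mul l)).measurable.comp
      (hX.measurable t) |>.aestronglyMeasurable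
  have hlN : ∀ x, |l * truncate N x| ≤ |l * N| := fun x => by
    rw [abs_mul, abs_mul, abs_of_nonneg hN]
    exact mul_le_mul_of_nonneg_left (abs_truncate_le hN x) (abs_nonneg l)
  have hgb : ∀ᵐ ω ∂P, ‖Real.cosh (l * truncate N (X t ω))‖ ≤ Real.cosh (l * N) :=
    ae_of_all _ fun ω => by
      rw [Real.norm_eq_abs, abs_of_pos (Real.cosh_pos _), Real.cosh_le_cosh]
      exact hlN _
  have hfb : ∀ᵐ ω ∂P, ‖Real.sinh (l * truncate N (X t ω))‖ ≤ Real.cosh (l * N) :=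
    ae_of_all _ fun ω => by
      rw [Real.norm_eq_abs, Real.abs_sinh]
      refine (Real.sinh_lt_cosh _).le.trans ?_
      rw [Real.cosh_le_cosh, abs_abs]
      exact hlN _
  have hX1 := hX.integrable t
  have ig : Integrable (fun ω => Real.cosh (l * truncate N (X t ω))) P := by
    simpa using (integrable_const (1 : ℝ)).mul_bdd hgm hgb
  have iXg := hX1.abs.mul_bdd hgm hgb
  have iXf := hX1.mul_bdd hfm hfb
  refine ⟨ig, ?_⟩
  have h0 := hX.integral_mul_sinh_le ht hN hl0.le
  obtain ⟨A, hA⟩ : ∃ A, A = ∫ ω, |X t ω| * Real.cosh (l * truncate N (X t ω)) ∂P := ⟨_, rfl⟩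
  obtain ⟨M, hM⟩ : ∃ M, M = ∫ ω, Real.cosh (l * truncate N (X t ω)) ∂P := ⟨_, rfl⟩
  have hA0 : 0 ≤ A := by
    rw [hA]
    exact integral_nonneg fun ω => mul_nonneg (abs_nonneg _) (Real.cosh_pos _).le
  have h1 : A - ∫ ω, |X t ω| ∂P ≤ ∫ ω, X t ω * Real.sinh (l * truncate N (X t ω)) ∂P := by
    rw [hA, ← integral_sub iXg hX1.abs]
    refine integral_mono (iXg.sub hX1.abs) iXf fun ω => ?_
    have := abs_mul_cosh_sub_one_le hN hl0.le (X t ω)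
    rw [mul_sub, mul_one] at this
    exact this
  have hlin : ∀ c : ℝ, ∫ ω, (1 + c * X t ω) * Real.cosh (l * truncate N (X t ω)) ∂P
      ≤ M + |c| * A := by
    intro c
    rw [hA, hM, ← integral_const_mul, ← integral_add ig (iXg.const_mul _)]
    refine integral_mono (((integrable_const 1).fun_add (hX1.const_mul c)).mul_bdd hgm hgb)
      (ig.fun_add (iXg.const_mul _)) fun ω => ?_
    have h2 : c * X t ω ≤ |c| * |X t ω| := (le_abs_self _).trans (abs_mul _ _).le
    have h3 := Real.cosh_pos (l * truncate N (X t ω))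
    change (1 + c * X t ω) * _ ≤ _ + |c| * (|X t ω| * _)
    nlinarith
  have h2 := hlin η
  have h3 : ∫ ω, (1 + θ * (X t ω / t)) * Real.cosh (l * truncate N (X t ω)) ∂P
      ≤ M + |θ| / t * A := by
    have h4 := hlin (θ / t)
    rw [abs_div, abs_of_pos ht'] at h4
    refine le_of_eq_of_le (integral_congr_ae (ae_of_all _ fun ω => ?_)) h4
    change (1 + θ * (X t ω / t)) * _ = (1 + θ / t * X t ω) * _
    ring
  have h4 : M ≤ Real.cosh l + A := by
    have h5 : M ≤ ∫ ω, (Real.cosh l + |X t ω| * Real.cosh (l * truncate N (X t ω))) ∂P := by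
      rw [hM]
      refine integral_mono ig ((integrable_const _).fun_add iXg) fun ω => ?_
      have h6 := Real.cosh_pos (l * truncate N (X t ω))
      have h7 := Real.cosh_pos l
      rcases le_total |X t ω| 1 with h | h
      · have h8 : Real.cosh (l * truncate N (X t ω)) ≤ Real.cosh l := by
          rw [Real.cosh_le_cosh, abs_mul]
          exact mul_le_of_le_one_right (abs_nonneg l) ((abs_truncate_le_abs hN _).trans h)
        have h9 := mul_nonneg (abs_nonneg (X t ω)) h6.le
        change Real.cosh (l * truncate N (X t ω)) ≤ _ + _
        linarith
      · have h9 := mul_le_mul_of_nonneg_right h h6.le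
        change Real.cosh (l * truncate N (X t ω)) ≤ _ + _
        linarith
    rwa [integral_add (integrable_const _) iXg, integral_const, probReal_univ, one_smul, ← hA]
      at h5
  have h5 : A - ∫ ω, |X t ω| ∂P ≤ l * t * (2 * M + κ * A) := by
    refine h1.trans (h0.trans (mul_le_mul_of_nonneg_left ?_ (by positivity)))
    rw [hκ]
    linarith
  have h6 : l * t * (2 * M + κ * A) ≤ l * t * (2 * Real.cosh l + (2 + κ) * A) :=
    mul_le_mul_of_nonneg_left (by linarith) (by positivity)
  have h7 : l * t * 2 ≤ 1 / 4 := by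
    rw [← hlt]
    exact mul_le_mul_of_nonneg_left (by linarith) (by positivity)
  have h8 : l * t * (2 * Real.cosh l + (2 + κ) * A) ≤ Real.cosh l + 1 / 4 * A := by
    have h9 := mul_le_mul_of_nonneg_right h7 (Real.cosh_pos l).le
    have h10 : l * t * (2 * Real.cosh l + (2 + κ) * A)
        = l * t * 2 * Real.cosh l + l * t * (2 + κ) * A := by ring
    rw [h10, hlt]
    linarith [Real.cosh_pos l]
  have h11 : 0 ≤ ∫ ω, |X t ω| ∂P := integral_nonneg fun ω => abs_nonneg _
  rw [← hM]
  linarith [Real.cosh_pos l]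

/-- The variables of a bi-Poisson process have exponential moments: the truncation can be removed by
Fatou's lemma. -/
theorem exists_integrable_exp_abs (hX : IsBiPoisson P η θ q X) (t : ℝ≥0) :
    ∃ l > 0, Integrable (fun ω => Real.exp (l * |X t ω|)) P := by
  rcases eq_or_ne t 0 with rfl | ht
  · refine ⟨1, one_pos, (integrable_const (1 : ℝ)).congr ?_⟩
    filter_upwards [hX.ae_zero] with ω hω
    simp [hω]
  obtain ⟨l, hl, C, hC⟩ := hX.exists_integral_cosh_truncate_le (pos_iff_ne_zero.2 ht)
  refine ⟨l, hl, ?_⟩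
  have hmeas := hX.measurable t
  have hcosh : Integrable (fun ω => Real.cosh (l * X t ω)) P := by
    have hm : ∀ n : ℕ, Measurable fun ω => ENNReal.ofReal (Real.cosh (l * truncate n (X t ω))) :=
      fun n => ((Real.continuous_cosh.comp ((continuous_truncate n).const_mul l)).measurable.comp
        hmeas).ennreal_ofReal
    have hlim : ∀ ω, liminf (fun n : ℕ => ENNReal.ofReal (Real.cosh (l * truncate n (X t ω)))) atTop
        = ENNReal.ofReal (Real.cosh (l * X t ω)) := by
      intro ω
      refine Tendsto.liminf_eq (tendsto_const_nhds.congr' ?_)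
      filter_upwards [eventually_ge_atTop ⌈|X t ω|⌉₊] with n hn
      rw [truncate_eq_self ((Nat.le_ceil _).trans (by exact_mod_cast hn))]
    refine ⟨(Real.continuous_cosh.measurable.comp (hmeas.const_mul l)).aestronglyMeasurable, ?_⟩
    rw [hasFiniteIntegral_iff_ofReal (ae_of_all _ fun ω => (Real.cosh_pos _).le)]
    calc ∫⁻ ω, ENNReal.ofReal (Real.cosh (l * X t ω)) ∂P
        = ∫⁻ ω, liminf (fun n : ℕ =>
            ENNReal.ofReal (Real.cosh (l * truncate n (X t ω)))) atTop ∂P := by simp only [hlim]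
      _ ≤ liminf (fun n : ℕ =>
            ∫⁻ ω, ENNReal.ofReal (Real.cosh (l * truncate n (X t ω))) ∂P) atTop :=
          lintegral_liminf_le hm
      _ ≤ liminf (fun _ : ℕ => ENNReal.ofReal C) atTop := by
          refine liminf_le_liminf (Eventually.of_forall fun n => ?_)
          rw [← ofReal_integral_eq_lintegral_ofReal (hC n n.cast_nonneg).1
            (ae_of_all _ fun ω => (Real.cosh_pos _).le)]
          exact ENNReal.ofReal_le_ofReal (hC n n.cast_nonneg).2
      _ = ENNReal.ofReal C := liminf_const _
      _ < ⊤ := ENNReal.ofReal_lt_top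
  refine (hcosh.const_mul 2).mono'
    (Real.continuous_exp.measurable.comp (hmeas.abs.const_mul l)).aestronglyMeasurable
    (ae_of_all _ fun ω => ?_)
  rw [Real.norm_eq_abs, Real.abs_exp, ← Real.cosh_abs, abs_mul, abs_of_pos hl, Real.cosh_eq]
  linarith [Real.exp_pos (-(l * |X t ω|))]

end IsBiPoisson

/-! ### The functional of mixed moments and its time inversion -/

namespace QuadraticHarness

open MvPolynomial

/-- The substitution `X_t ↦ t X_{1/t}` of polynomials; `X_0` is mapped to `0`. -/
noncomputable def invert : MvPolynomial ℝ≥0 ℝ →ₐ[ℝ] MvPolynomial ℝ≥0 ℝ :=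
  aeval fun t : ℝ≥0 => C (t : ℝ) * X t⁻¹

lemma invert_X (t : ℝ≥0) : invert (X t) = C (t : ℝ) * X t⁻¹ := aeval_X _ t

lemma eval_invert (x : ℝ≥0 → ℝ) (f : MvPolynomial ℝ≥0 ℝ) :
    eval x (invert f) = eval (fun t : ℝ≥0 => (t : ℝ) * x t⁻¹) f := by
  induction f using MvPolynomial.induction_on with
  | C a => rw [← algebraMap_eq, AlgHom.commutes, algebraMap_eq, eval_C, eval_C]
  | add p q hp hq => rw [map_add, map_add, hp, hq, map_add]
  | mul_X p i hp => rw [map_mul, map_mul, hp, map_mul, invert_X, map_mul, eval_C, eval_X, eval_X]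

lemma invert_mem_supported {A B : Set ℝ≥0} (h : ∀ r ∈ A, r ≠ 0 → r⁻¹ ∈ B)
    {f : MvPolynomial ℝ≥0 ℝ} (hf : f ∈ supported ℝ A) : invert f ∈ supported ℝ B := by
  have h1 : supported ℝ A ≤ (supported ℝ B).comap invert := by
    refine Algebra.adjoin_le ?_
    rintro _ ⟨r, hr, rfl⟩
    change invert (X r) ∈ supported ℝ B
    rw [invert_X]
    rcases eq_or_ne r 0 with rfl | h0
    · simp
    · exact mul_mem (Subalgebra.algebraMap_mem _ _) (X_mem_supported.2 (h r hr h0))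
  exact h1 hf

lemma invert_bridgeMean {s t u : ℝ≥0} (hs : 0 < s) (hst : s < t) (htu : t < u) :
    invert (bridgeMean s t u) = C (t : ℝ) * bridgeMean u⁻¹ t⁻¹ s⁻¹ := by
  refine MvPolynomial.funext fun x => ?_
  have hs' : (0 : ℝ) < s := hs
  have hst' : (s : ℝ) < t := hst
  have htu' : (t : ℝ) < u := htu
  have ht' : (0 : ℝ) < t := hs'.trans hst'
  have hu' : (0 : ℝ) < u := ht'.trans htu'
  have h1 : (u : ℝ) - s ≠ 0 := by linarith
  have h2 : ((s : ℝ)⁻¹ - (u : ℝ)⁻¹) = (u - s) / (s * u) := by field_simp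
  rw [eval_invert]
  simp only [bridgeMean, map_add, map_mul, eval_C, eval_X, NNReal.coe_inv, h2]
  field_simp
  ring

lemma invert_bridgeVariance {η θ q : ℝ} (hq : q ≤ 1) {s t u : ℝ≥0} (hs : 0 < s) (hst : s < t)
    (htu : t < u) : invert (bridgeVariance θ η q s t u) =
      C ((t : ℝ) ^ 2) * bridgeVariance η θ q u⁻¹ t⁻¹ s⁻¹ := by
  refine MvPolynomial.funext fun x => ?_
  have hs' : (0 : ℝ) < s := hs
  have hst' : (s : ℝ) < t := hst
  have htu' : (t : ℝ) < u := htu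
  have ht' : (0 : ℝ) < t := hs'.trans hst'
  have hu' : (0 : ℝ) < u := ht'.trans htu'
  have h1 : (u : ℝ) - s ≠ 0 := by linarith
  have h2 : ((s : ℝ)⁻¹ - (u : ℝ)⁻¹) = (u - s) / (s * u) := by field_simp
  obtain ⟨D, hD⟩ : ∃ D, D = (u : ℝ) - q * s := ⟨_, rfl⟩
  have hD0 : D ≠ 0 := by
    have : 0 < D := by rw [hD]; nlinarith
    exact this.ne'
  have h3 : ((s : ℝ)⁻¹ - q * (u : ℝ)⁻¹) = D / (s * u) := by rw [hD]; field_simp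
  rw [eval_invert]
  simp only [bridgeVariance, map_add, map_sub, map_mul, map_one, eval_C, eval_X, NNReal.coe_inv, h2,
    h3, ← hD]
  field_simp
  ring

/-- Time inversion of a moment functional exchanges the parameters `η` and `θ`. The identities for
the inverted functional with `s = 0` come from conditioning on the past only. -/
lemma IsMomentFunctional.invert {η θ q : ℝ} (hq : q ≤ 1) {L : MvPolynomial ℝ≥0 ℝ →ₗ[ℝ] ℝ}
    (hL : IsMomentFunctional η θ q L)
    (hpast : ∀ s t : ℝ≥0, s < t → ∀ W ∈ supported ℝ (Set.Iic s),
      L (X t ^ 2 * W) = L ((X s ^ 2 + C ((t : ℝ) - s) * (1 + C η * X s)) * W)) :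
    IsMomentFunctional θ η q (L ∘ₗ invert.toLinearMap) where
  map_one := by
    rw [LinearMap.comp_apply, AlgHom.toLinearMap_apply, _root_.map_one]
    exact hL.map_one
  map_X_zero_mul f := by simp [invert_X]
  martingale s t hst W hW := by
    simp only [LinearMap.comp_apply, AlgHom.toLinearMap_apply, map_mul, invert_X]
    have ht : 0 < t := pos_of_gt hst
    have ht' : (t : ℝ) ≠ 0 := (NNReal.coe_pos.2 ht).ne'
    have hV : ∀ r : ℝ≥0, 0 < r → r ≤ s⁻¹ ∨ s = 0 →
        QuadraticHarness.invert W ∈ supported ℝ (Set.Iic 0 ∪ Set.Ici r) := by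
      intro r hr hrs
      refine invert_mem_supported (fun v hv hv0 => Or.inr ?_) hW
      rcases hrs with h | rfl
      · exact h.trans (inv_anti₀ (pos_iff_ne_zero.2 hv0) hv)
      · exact absurd (le_antisymm hv zero_le) hv0
    rcases eq_or_ne s 0 with rfl | hs
    · have hV0 : QuadraticHarness.invert W ∈ supported ℝ (Set.Iic (0 : ℝ≥0)) :=
        invert_mem_supported (fun v hv hv0 => absurd (le_antisymm hv zero_le) hv0) hW
      have h := hL.martingale 0 t⁻¹ (by positivity) _ hV0
      rw [hL.map_X_zero_mul] at h
      simp [C_mul', h]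
    · have hs0 : 0 < s := pos_iff_ne_zero.2 hs
      have hs' : (s : ℝ) ≠ 0 := (NNReal.coe_pos.2 hs0).ne'
      have h := hL.harness 0 t⁻¹ s⁻¹ (by positivity) (inv_strictAnti₀ hs0 hst) _
        (hV s⁻¹ (by positivity) (Or.inl le_rfl))
      simp only [bridgeMean, add_mul, C_mul', map_add, map_smul, hL.map_X_zero_mul,
        smul_mul_assoc, smul_eq_mul, NNReal.coe_inv, NNReal.coe_zero] at h ⊢
      rw [h]
      field_simp
      simp
  harness s t u hst htu W hW := by
    simp only [LinearMap.comp_apply, AlgHom.toLinearMap_apply, map_mul, invert_X]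
    have ht : 0 < t := pos_of_gt hst
    have hu : 0 < u := ht.trans htu
    have ht' : (t : ℝ) ≠ 0 := (NNReal.coe_pos.2 ht).ne'
    have hu' : (u : ℝ) ≠ 0 := (NNReal.coe_pos.2 hu).ne'
    rcases eq_or_ne s 0 with rfl | hs
    · have hV : QuadraticHarness.invert W ∈ supported ℝ (Set.Iic u⁻¹) := by
        refine invert_mem_supported (fun v hv hv0 => ?_) hW
        rcases hv with h | h
        · exact absurd (le_antisymm h zero_le) hv0
        · exact inv_anti₀ hu h
      have h := hL.martingale u⁻¹ t⁻¹ (inv_strictAnti₀ ht htu) _ hV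
      rw [mul_assoc, C_mul', map_smul, h, ← map_smul, ← smul_mul_assoc]
      congr 2
      refine MvPolynomial.funext fun x => ?_
      simp only [bridgeMean, smul_eval, eval_invert, map_add, map_mul, eval_C, eval_X,
        NNReal.coe_zero, zero_mul, mul_zero, sub_zero, zero_add]
      field_simp
    · have hs0 : 0 < s := pos_iff_ne_zero.2 hs
      have hV : QuadraticHarness.invert W ∈ supported ℝ (Set.Iic u⁻¹ ∪ Set.Ici s⁻¹) := by
        refine invert_mem_supported (fun v hv hv0 => ?_) hW
        rcases hv with h | h
        · exact Or.inr (inv_anti₀ (pos_iff_ne_zero.2 hv0) h)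
        · exact Or.inl (inv_anti₀ hu h)
      have h := hL.harness u⁻¹ t⁻¹ s⁻¹ (inv_strictAnti₀ ht htu) (inv_strictAnti₀ hs0 hst) _ hV
      rw [invert_bridgeMean hs0 hst htu, mul_assoc, mul_assoc, C_mul', C_mul', map_smul, map_smul,
        h]
  quadratic s t u hst htu W hW := by
    simp only [LinearMap.comp_apply, AlgHom.toLinearMap_apply, map_mul, map_pow, map_add, invert_X]
    have ht : 0 < t := pos_of_gt hst
    have hu : 0 < u := ht.trans htu
    have ht' : (t : ℝ) ≠ 0 := (NNReal.coe_pos.2 ht).ne'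
    have hu' : (u : ℝ) ≠ 0 := (NNReal.coe_pos.2 hu).ne'
    rw [mul_pow, ← C_pow, mul_assoc, C_mul', map_smul]
    rcases eq_or_ne s 0 with rfl | hs
    · have hV : QuadraticHarness.invert W ∈ supported ℝ (Set.Iic u⁻¹) := by
        refine invert_mem_supported (fun v hv hv0 => ?_) hW
        rcases hv with h | h
        · exact absurd (le_antisymm h zero_le) hv0
        · exact inv_anti₀ hu h
      rw [hpast u⁻¹ t⁻¹ (inv_strictAnti₀ ht htu) _ hV, ← map_smul, ← smul_mul_assoc]
      congr 2
      refine MvPolynomial.funext fun x => ?_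
      simp only [bridgeMean, bridgeVariance, smul_eval, eval_invert, map_add, map_mul, map_pow,
        map_sub, _root_.map_one, eval_C, eval_X, NNReal.coe_inv, NNReal.coe_zero,
        zero_mul, mul_zero, sub_zero, zero_add]
      field_simp
      ring
    · have hs0 : 0 < s := pos_iff_ne_zero.2 hs
      have hV : QuadraticHarness.invert W ∈ supported ℝ (Set.Iic u⁻¹ ∪ Set.Ici s⁻¹) := by
        refine invert_mem_supported (fun v hv hv0 => ?_) hW
        rcases hv with h | h
        · exact Or.inr (inv_anti₀ (pos_iff_ne_zero.2 hv0) h)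
        · exact Or.inl (inv_anti₀ hu h)
      rw [hL.quadratic u⁻¹ t⁻¹ s⁻¹ (inv_strictAnti₀ ht htu) (inv_strictAnti₀ hs0 hst) _ hV,
        invert_bridgeMean hs0 hst htu, invert_bridgeVariance hq hs0 hst htu, mul_pow, ← C_pow,
        ← mul_add, mul_assoc, C_mul', map_smul]

lemma zero_mem_interior_integrableExpSet {Ω : Type*} [MeasurableSpace Ω] {P : Measure Ω}
    {S : Ω → ℝ} (hS : Measurable S)
    (h : ∃ l > 0, Integrable (fun ω => Real.exp (l * |S ω|)) P) :
    0 ∈ interior (integrableExpSet S P) := by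
  obtain ⟨l, hl, hi⟩ := h
  refine mem_interior.2 ⟨Set.Ioo (-l) l, fun a ha => ?_, isOpen_Ioo, by simp [hl]⟩
  refine hi.mono' (Real.continuous_exp.measurable.comp (hS.const_mul a)).aestronglyMeasurable
    (ae_of_all _ fun ω => ?_)
  rw [Real.norm_eq_abs, Real.abs_exp, Real.exp_le_exp]
  calc a * S ω ≤ |a| * |S ω| := (le_abs_self _).trans (abs_mul _ _).le
    _ ≤ l * |S ω| := by
      gcongr
      exact abs_le.2 ⟨ha.1.le, ha.2.le⟩

lemma aestronglyMeasurable_eval {Ω : Type*} {m m₀ : MeasurableSpace Ω} {P : Measure Ω}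
    {X : ℝ≥0 → Ω → ℝ} {A : Set ℝ≥0}
    (h : ∀ r ∈ A, AEStronglyMeasurable[m] (X r) P) {f : MvPolynomial ℝ≥0 ℝ}
    (hf : f ∈ supported ℝ A) : AEStronglyMeasurable[m] (fun ω => eval (fun r => X r ω) f) P := by
  induction hf using Algebra.adjoin_induction with
  | mem f hf =>
    obtain ⟨r, hr, rfl⟩ := hf
    simpa using h r hr
  | algebraMap a => simpa using aestronglyMeasurable_const
  | add f g _ _ hf hg => simp only [map_add]; exact hf.add hg
  | mul f g _ _ hf hg => simp only [map_mul]; exact hf.mul hg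

end QuadraticHarness

namespace IsBiPoisson

open MvPolynomial QuadraticHarness

variable {Ω : Type*} [MeasurableSpace Ω] {P : Measure Ω} [IsProbabilityMeasure P]
  {η θ q : ℝ} {X : ℝ≥0 → Ω → ℝ}

lemma memLp_eval (hX : IsBiPoisson P η θ q X) (f : MvPolynomial ℝ≥0 ℝ) :
    ∀ p : ℝ≥0, MemLp (fun ω => eval (fun r => X r ω) f) p P := by
  induction f using MvPolynomial.induction_on with
  | C a => intro p; simpa using memLp_const a
  | add f g hf hg => intro p; simp only [map_add]; exact (hf p).add (hg p)
  | mul_X f i hf =>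
    intro p
    have hX' := memLp_of_mem_interior_integrableExpSet (zero_mem_interior_integrableExpSet
      (hX.measurable i) (hX.exists_integrable_exp_abs i)) (2 * p)
    have : ENNReal.HolderTriple ((2 * p : ℝ≥0) : ENNReal) ((2 * p : ℝ≥0) : ENNReal) p := ⟨by
      rw [ENNReal.coe_mul, ENNReal.mul_inv (by simp) (by simp), ← two_mul, ← mul_assoc,
        ENNReal.coe_ofNat, ENNReal.mul_inv_cancel (by simp) (by simp), one_mul]⟩
    have h := (hf (2 * p)).mul (r := p) hX'
    simpa [Pi.mul_def, mul_comm] using h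

lemma integrable_eval (hX : IsBiPoisson P η θ q X) (f : MvPolynomial ℝ≥0 ℝ) :
    Integrable (fun ω => eval (fun r => X r ω) f) P :=
  memLp_one_iff_integrable.1 (by simpa using hX.memLp_eval f 1)

/-- The functional `f ↦ E(f(X))` of mixed moments. -/
noncomputable def momentFunctional (hX : IsBiPoisson P η θ q X) :
    MvPolynomial ℝ≥0 ℝ →ₗ[ℝ] ℝ where
  toFun f := ∫ ω, eval (fun r => X r ω) f ∂P
  map_add' f g := by
    simp only [map_add]
    exact integral_add (hX.integrable_eval f) (hX.integrable_eval g)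
  map_smul' c f := by
    simp only [smul_eval, RingHom.id_apply, smul_eq_mul]
    exact integral_const_mul c _

lemma momentFunctional_apply (hX : IsBiPoisson P η θ q X) (f : MvPolynomial ℝ≥0 ℝ) :
    hX.momentFunctional f = ∫ ω, eval (fun r => X r ω) f ∂P := rfl

lemma isMomentFunctional (hX : IsBiPoisson P η θ q X) :
    IsMomentFunctional η θ q hX.momentFunctional where
  map_one := by simp [momentFunctional_apply]
  map_X_zero_mul f := by
    rw [momentFunctional_apply]
    refine integral_eq_zero_of_ae ?_
    filter_upwards [hX.ae_zero] with ω hω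
    simp [hω]
  martingale s t hst W hW := by
    have hi := hX.integrable_eval (MvPolynomial.X t * W)
    simp only [momentFunctional_apply, map_mul, eval_X] at hi ⊢
    exact hX.integral_mul_past hst (aestronglyMeasurable_eval (fun r hr =>
      (stronglyMeasurable_pastSigma hr).aestronglyMeasurable) hW) hi
  harness s t u hst htu W hW := by
    have hi := hX.integrable_eval (MvPolynomial.X t * W)
    simp only [momentFunctional_apply, bridgeMean, map_add, map_mul, eval_X, eval_C] at hi ⊢
    exact integral_mul_eq_of_condExp_ae_eq (hX.pastFutureSigma_le s u) (hX.integrable t)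
      (hX.harness s t u hst htu) (aestronglyMeasurable_eval (fun r hr =>
        hX.aestronglyMeasurable_pastFutureSigma (hst.trans htu) hr) hW) hi
  quadratic s t u hst htu W hW := by
    have hi := hX.integrable_eval (MvPolynomial.X t ^ 2 * W)
    simp only [momentFunctional_apply, map_mul, map_pow, eval_X] at hi ⊢
    refine integral_mul_eq_of_condExp_ae_eq (hX.pastFutureSigma_le s u) (hX.integrable_sq t)
      ?_ (aestronglyMeasurable_eval (fun r hr =>
        hX.aestronglyMeasurable_pastFutureSigma (hst.trans htu) hr) hW) hi
    filter_upwards [hX.condExp_sq hst htu] with ω hω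
    rw [hω]
    simp only [bridgeMean, bridgeVariance, map_add, map_sub, map_mul, map_pow, map_one, eval_X,
      eval_C]
    ring

/-- For equal parameters `η = θ`, a bi-Poisson process and its time inversion have the same mixed
moments. -/
theorem integral_eval_inversion (hX : IsBiPoisson P θ θ q X) (f : MvPolynomial ℝ≥0 ℝ) :
    ∫ ω, eval (fun r : ℝ≥0 => (r : ℝ) * X r⁻¹ ω) f ∂P = ∫ ω, eval (fun r => X r ω) f ∂P := by
  have h := (hX.isMomentFunctional.invert hX.le_one fun s t hst W hW => by
    have hi := hX.integrable_eval (MvPolynomial.X t ^ 2 * W)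
    simp only [momentFunctional_apply, map_mul, map_pow, map_add, map_one, eval_X, eval_C] at hi ⊢
    exact hX.integral_sq_mul_past hst (aestronglyMeasurable_eval (fun r hr =>
      (stronglyMeasurable_pastSigma hr).aestronglyMeasurable) hW) hi).unique hX.le_one
    hX.isMomentFunctional
  have h' := LinearMap.congr_fun h f
  simpa only [LinearMap.comp_apply, AlgHom.toLinearMap_apply, momentFunctional_apply,
    eval_invert] using h'

end IsBiPoisson

/-! ### Determination of laws by moments -/

namespace QuadraticHarness

open Filter Topology

/-- Two random variables with exponential moments and the same moments have the same law: their
complex moment generating functions have the same Taylor series at `0`, hence agree on a strip that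
contains the imaginary axis. -/
lemma map_eq_of_integral_pow_eq {Ω : Type*} [MeasurableSpace Ω] {P : Measure Ω}
    [IsFiniteMeasure P] {S T : Ω → ℝ} (hS : Measurable S) (hT : Measurable T)
    (hS' : 0 ∈ interior (integrableExpSet S P)) (hT' : 0 ∈ interior (integrableExpSet T P))
    (h : ∀ n : ℕ, ∫ ω, S ω ^ n ∂P = ∫ ω, T ω ^ n ∂P) : P.map S = P.map T := by
  set U : Set ℝ := interior (integrableExpSet S P) ∩ interior (integrableExpSet T P) with hU
  have hderiv : ∀ (Z : Ω → ℝ), 0 ∈ interior (integrableExpSet Z P) → ∀ n : ℕ,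
      iteratedDeriv n (complexMGF Z P) 0 = ((∫ ω, Z ω ^ n ∂P : ℝ) : ℂ) := by
    intro Z hZ n
    rw [iteratedDeriv_complexMGF (by simpa using hZ), ← integral_complex_ofReal]
    simp
  have heq : complexMGF S P =ᶠ[𝓝 0] complexMGF T P := by
    have h1 := (analyticAt_complexMGF (X := S) (μ := P) (z := 0)
      (by simpa using hS')).hasFPowerSeriesAt
    have h2 := (analyticAt_complexMGF (X := T) (μ := P) (z := 0)
      (by simpa using hT')).hasFPowerSeriesAt
    simp only [hderiv S hS', hderiv T hT', h] at h1 h2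
    have h3 := h1.sub h2
    rw [sub_self] at h3
    filter_upwards [h3.eventually_eq_zero] with z hz
    exact sub_eq_zero.1 hz
  have hon : Set.EqOn (complexMGF S P) (complexMGF T P) {z | z.re ∈ U} := by
    refine AnalyticOnNhd.eqOn_of_preconnected_of_eventuallyEq (z₀ := 0)
      (analyticOnNhd_complexMGF.mono fun z hz => hz.1)
      (analyticOnNhd_complexMGF.mono fun z hz => hz.2)
      ((convex_integrableExpSet.interior.inter convex_integrableExpSet.interior).linear_preimage
        Complex.reLm).isPreconnected (by simpa using ⟨hS', hT'⟩) heq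
  refine Measure.ext_of_charFun (funext fun t => ?_)
  rw [← complexMGF_mul_I hS.aemeasurable, ← complexMGF_mul_I hT.aemeasurable]
  exact hon (by simpa using ⟨hS', hT'⟩)

/-- Finite linear combinations of variables with exponential moments have exponential moments. -/
lemma exists_integrable_exp_abs_sum {Ω ι : Type*} [MeasurableSpace Ω] {P : Measure Ω}
    [IsFiniteMeasure P] (I : Finset ι) {Y : ι → Ω → ℝ} (c : ι → ℝ) (hY : ∀ i, Measurable (Y i))
    (h : ∀ i, ∃ l > 0, Integrable (fun ω => Real.exp (l * |Y i ω|)) P) :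
    ∃ l > 0, Integrable (fun ω => Real.exp (l * |∑ i ∈ I, c i * Y i ω|)) P := by
  classical
  induction I using Finset.induction_on with
  | empty => exact ⟨1, one_pos, by simp⟩
  | insert a I ha ih =>
    obtain ⟨l, hl, hi⟩ := ih
    obtain ⟨k, hk, hj⟩ := h a
    obtain ⟨r, hr, hrl, hrk⟩ : ∃ r > 0, 2 * r ≤ l ∧ 2 * r * |c a| ≤ k := by
      refine ⟨min (l / 2) (k / (2 * (1 + |c a|))), by positivity, ?_, ?_⟩
      · linarith [min_le_left (l / 2) (k / (2 * (1 + |c a|)))]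
      · have h1 := min_le_right (l / 2) (k / (2 * (1 + |c a|)))
        calc 2 * min (l / 2) (k / (2 * (1 + |c a|))) * |c a|
            ≤ 2 * (k / (2 * (1 + |c a|))) * |c a| := by gcongr
          _ = k * (|c a| / (1 + |c a|)) := by field_simp
          _ ≤ k * 1 := by
            gcongr
            rw [div_le_one (by positivity)]
            linarith
          _ = k := mul_one k
    refine ⟨r, hr, (hi.add hj).mono' ?_ (ae_of_all _ fun ω => ?_)⟩
    · have hm : Measurable fun ω => ∑ i ∈ insert a I, c i * Y i ω :=
        Finset.measurable_fun_sum _ fun i _ => (hY i).const_mul (c i)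
      exact (Real.continuous_exp.measurable.comp (hm.abs.const_mul r)).aestronglyMeasurable
    · rw [Real.norm_eq_abs, Real.abs_exp, Finset.sum_insert ha, Pi.add_apply]
      have h1 : |c a * Y a ω + ∑ i ∈ I, c i * Y i ω|
          ≤ |c a| * |Y a ω| + |∑ i ∈ I, c i * Y i ω| :=
        (abs_add_le _ _).trans_eq (by rw [abs_mul])
      -- `r (u + v) ≤ max (2 r u) (2 r v)`
      rcases le_total (|c a| * |Y a ω|) |∑ i ∈ I, c i * Y i ω| with h2 | h2
      · have h3 : r * |c a * Y a ω + ∑ i ∈ I, c i * Y i ω| ≤ l * |∑ i ∈ I, c i * Y i ω| :=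
          calc _ ≤ r * (2 * |∑ i ∈ I, c i * Y i ω|) := by gcongr; linarith
            _ = 2 * r * |∑ i ∈ I, c i * Y i ω| := by ring
            _ ≤ _ := by gcongr
        exact (Real.exp_le_exp.2 h3).trans (le_add_of_nonneg_right (Real.exp_pos _).le)
      · have h3 : r * |c a * Y a ω + ∑ i ∈ I, c i * Y i ω| ≤ k * |Y a ω| :=
          calc _ ≤ r * (2 * (|c a| * |Y a ω|)) := by gcongr; linarith
            _ = 2 * r * |c a| * |Y a ω| := by ring
            _ ≤ _ := by gcongr
        exact (Real.exp_le_exp.2 h3).trans (le_add_of_nonneg_left (Real.exp_pos _).le)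

end QuadraticHarness

namespace IsBiPoisson

open QuadraticHarness

lemma measurable_timeInversion {Ω : Type*} [MeasurableSpace Ω] {P : Measure Ω} {η θ q : ℝ}
    {X : ℝ≥0 → Ω → ℝ} (hX : IsBiPoisson P η θ q X) (t : Set.Ioi (0 : ℝ≥0)) :
    Measurable (timeInversion X t) :=
  (hX.measurable _).const_mul _

variable {Ω : Type*} [MeasurableSpace Ω] {P : Measure Ω} [IsProbabilityMeasure P]
  {θ q : ℝ} {X : ℝ≥0 → Ω → ℝ}

/-- By the Cramér–Wold device the finite-dimensional laws are determined by the laws of linear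
combinations, and these by their moments. -/
theorem sameFiniteDimLaws_timeInversion (hX : IsBiPoisson P θ θ q X) :
    SameFiniteDimLaws P (timeInversion X) (fun (t : Set.Ioi (0 : ℝ≥0)) => X t) := by
  intro I
  have hYm := hX.measurable_timeInversion
  have hYe : ∀ t : Set.Ioi (0 : ℝ≥0),
      ∃ l > 0, Integrable (fun ω => Real.exp (l * |timeInversion X t ω|)) P := by
    intro t
    have ht : (0 : ℝ) < (t : ℝ≥0) := t.2
    obtain ⟨l, hl, hi⟩ := hX.exists_integrable_exp_abs (t : ℝ≥0)⁻¹
    refine ⟨l / (t : ℝ≥0), by positivity, hi.congr (ae_of_all _ fun ω => ?_)⟩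
    simp only [timeInversion, abs_mul, abs_of_pos ht]
    congr 1
    field_simp
  have mY : Measurable fun ω (t : I) => timeInversion X (t : Set.Ioi (0 : ℝ≥0)) ω :=
    measurable_pi_lambda _ fun t => hYm t
  have mX : Measurable fun ω (t : I) => X ((t : Set.Ioi (0 : ℝ≥0)) : ℝ≥0) ω :=
    measurable_pi_lambda _ fun t => hX.measurable _
  have : IsProbabilityMeasure (P.map fun ω (t : I) => timeInversion X (t : Set.Ioi (0 : ℝ≥0)) ω) :=
    Measure.isProbabilityMeasure_map mY.aemeasurable
  have : IsProbabilityMeasure (P.map fun ω (t : I) => X ((t : Set.Ioi (0 : ℝ≥0)) : ℝ≥0) ω) :=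
    Measure.isProbabilityMeasure_map mX.aemeasurable
  refine Measure.ext_of_charFunDual (funext fun φ => ?_)
  rw [charFunDual_eq_charFun_map_one, charFunDual_eq_charFun_map_one,
    Measure.map_map φ.continuous.measurable mY, Measure.map_map φ.continuous.measurable mX]
  congr 1
  classical
  obtain ⟨c, hc⟩ : ∃ c : I → ℝ, ∀ x : I → ℝ, φ x = ∑ i ∈ Finset.univ, c i * x i := by
    refine ⟨fun i => φ (Pi.single i 1), fun x => ?_⟩
    conv_lhs => rw [pi_eq_sum_univ' x, map_sum]
    refine Finset.sum_congr rfl fun i _ => ?_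
    rw [map_smul, smul_eq_mul, mul_comm]
  refine map_eq_of_integral_pow_eq (φ.continuous.measurable.comp mY)
    (φ.continuous.measurable.comp mX) ?_ ?_ fun n => ?_
  · refine zero_mem_interior_integrableExpSet (φ.continuous.measurable.comp mY) ?_
    simp only [Function.comp_apply, hc]
    exact exists_integrable_exp_abs_sum Finset.univ c (fun i => hYm i) fun i => hYe i
  · refine zero_mem_interior_integrableExpSet (φ.continuous.measurable.comp mX) ?_
    simp only [Function.comp_apply, hc]
    exact exists_integrable_exp_abs_sum Finset.univ c (fun i => hX.measurable _)
      fun i => hX.exists_integrable_exp_abs _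
  · have h := hX.integral_eval_inversion
      ((∑ i : I, MvPolynomial.C (c i) * MvPolynomial.X ((i : Set.Ioi (0 : ℝ≥0)) : ℝ≥0)) ^ n)
    simpa only [map_pow, map_sum, map_mul, MvPolynomial.eval_C, MvPolynomial.eval_X,
      Function.comp_apply, hc, timeInversion] using h

end IsBiPoisson

/-! ### The auxiliary process -/

namespace QuadraticHarness

/-- The value of `Z_t` that corresponds to the value `x` of `X_t`: the inverse of `valueOfLine`. -/
noncomputable def lineOfValue (θ : ℝ) (t : ℝ≥0) (x : ℝ) : ℝ :=
  if t < 1 then (x + t / θ) / (θ * (1 - (t : ℝ)))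
  else if t = 1 then (x + 1 / θ) / θ
  else (x + 1 / θ) / (θ * ((t : ℝ) - 1))

lemma measurable_lineOfValue (θ : ℝ) (t : ℝ≥0) : Measurable (lineOfValue θ t) := by
  unfold lineOfValue
  split_ifs <;> fun_prop

lemma lineOfValue_valueOfLine {θ : ℝ} (hθ : 0 < θ) (t : ℝ≥0) (z : ℝ) :
    lineOfValue θ t (valueOfLine θ t z) = z := by
  unfold lineOfValue valueOfLine
  split_ifs with h1 h2
  · have h : (1 : ℝ) - t ≠ 0 := (sub_pos.2 (NNReal.coe_lt_coe.2 h1)).ne'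
    field_simp
    ring
  · field_simp
    ring
  · have h : (t : ℝ) - 1 ≠ 0 :=
      sub_ne_zero.2 fun h => h2 (by exact_mod_cast h)
    field_simp
    ring

/-- The lines at the times `t` and `1/t` correspond to each other under time inversion. -/
lemma mul_valueOfLine_inv (θ : ℝ) {t : ℝ≥0} (ht : 0 < t) (z : ℝ) :
    (t : ℝ) * valueOfLine θ t⁻¹ z = valueOfLine θ t z := by
  have ht' : (t : ℝ) ≠ 0 := (NNReal.coe_pos.2 ht).ne'
  unfold valueOfLine
  rcases lt_trichotomy t 1 with h | rfl | h
  · have h1 : 1 < t⁻¹ := (one_lt_inv₀ ht).2 h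
    rw [if_neg h1.not_gt, if_neg h1.ne', if_pos h, NNReal.coe_inv]
    field_simp
  · simp
  · have h1 : t⁻¹ < 1 := inv_lt_one_of_one_lt₀ h
    rw [if_pos h1, if_neg h.not_gt, if_neg h.ne', NNReal.coe_inv]
    field_simp

end QuadraticHarness

namespace IsBiPoisson

open QuadraticHarness

theorem sameTransitionsInverted {Ω : Type*} [MeasurableSpace Ω] {P : Measure Ω}
    [IsProbabilityMeasure P] {θ q : ℝ} {X : ℝ≥0 → Ω → ℝ} (hX : IsBiPoisson P θ θ q X)
    (hθ : 0 < θ) {Z : ℝ≥0 → Ω → ℝ} (hZ : ∀ t ω, X t ω = valueOfLine θ t (Z t ω)) :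
    SameTransitionsInverted P Z := by
  intro s t hs hst
  have ht : 0 < t := hs.trans hst
  have e1 : ∀ r, Z r = fun ω => lineOfValue θ r (X r ω) := fun r => by
    ext ω
    rw [hZ, lineOfValue_valueOfLine hθ]
  have e2 : ∀ r : ℝ≥0, 0 < r → Z r⁻¹ = fun ω => lineOfValue θ r ((r : ℝ) * X r⁻¹ ω) :=
    fun r hr => by
      ext ω
      rw [hZ, mul_valueOfLine_inv θ hr, lineOfValue_valueOfLine hθ]
  have mZ : ∀ r, Measurable (Z r) := fun r => by
    rw [e1]
    exact (measurable_lineOfValue θ r).comp (hX.measurable r)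
  have hpair : P.map (fun ω => (Z s ω, Z t ω)) = P.map (fun ω => (Z s⁻¹ ω, Z t⁻¹ ω)) := by
    classical
    let s' : Set.Ioi (0 : ℝ≥0) := ⟨s, hs⟩
    let t' : Set.Ioi (0 : ℝ≥0) := ⟨t, ht⟩
    let I : Finset (Set.Ioi (0 : ℝ≥0)) := {s', t'}
    have hsI : s' ∈ I := by simp [I]
    have htI : t' ∈ I := by simp [I]
    have hm : Measurable fun x : I → ℝ =>
        (lineOfValue θ s (x ⟨s', hsI⟩), lineOfValue θ t (x ⟨t', htI⟩)) :=
      ((measurable_lineOfValue θ s).comp (measurable_pi_apply _)).prodMk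
        ((measurable_lineOfValue θ t).comp (measurable_pi_apply _))
    have h := congrArg (Measure.map fun x : I → ℝ =>
        (lineOfValue θ s (x ⟨s', hsI⟩), lineOfValue θ t (x ⟨t', htI⟩)))
      (hX.sameFiniteDimLaws_timeInversion I)
    rw [Measure.map_map hm (measurable_pi_lambda _ fun r : I => hX.measurable_timeInversion r.1),
      Measure.map_map hm (measurable_pi_lambda _ fun r => hX.measurable _)] at h
    rw [e1 s, e1 t, e2 s hs, e2 t ht]
    exact h.symm
  have hlaw : P.map (Z s) = P.map (Z s⁻¹) := by
    have h := congrArg (Measure.map Prod.fst) hpair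
    rwa [Measure.map_map measurable_fst ((mZ s).prodMk (mZ t)),
      Measure.map_map measurable_fst ((mZ _).prodMk (mZ _))] at h
  refine ⟨hlaw, condDistrib_ae_eq_of_measure_eq_compProd _ (mZ t).aemeasurable ?_⟩
  rw [hpair, hlaw, compProd_map_condDistrib (mZ _).aemeasurable]

end IsBiPoisson

theorem mainTheorem2 {Ω : Type*} [MeasurableSpace Ω] (P : Measure Ω) [IsProbabilityMeasure P]
    (θ q : ℝ) (X : ℝ≥0 → Ω → ℝ) (hX : IsBiPoisson P θ θ q X) :
    SameFiniteDimLaws P (timeInversion X) (fun (t : Set.Ioi (0 : ℝ≥0)) => X t) ∧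
    (q = 1 → 0 < θ → ∀ Z : ℝ≥0 → Ω → ℝ, (∀ t ω, X t ω = valueOfLine θ t (Z t ω)) →
      SameTransitionsInverted P Z) :=
  ⟨hX.sameFiniteDimLaws_timeInversion, fun _ hθ _ hZ => hX.sameTransitionsInverted hθ hZ⟩
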